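/- **Setting.** Let $\mathcal X$ be a finite alphabet, $1\le K\le M_2\le M_1$ integers, $\alpha,\beta>0$ real, and $\xi_n=\lceil\alpha n\rceil$, $\chi_n=\lceil\beta n\rceil$. There are $M_1+M_2$ independent sequences: $X_i=(X_{i,1},X_{i,2},\dots)$ is i.i.d. from $P_i$ ($i\le M_1$) and $Y_j=(Y_{j,1},Y_{j,2},\dots)$ is i.i.d. from $Q_j$ ($j\le M_2$). At time $n$ one has observed the first $\xi_n$ symbols of each $X_i$ and the first $\chi_n$ symbols of each $Y_j$; let $\mathcal F_n$ be the $\sigma$-algebra that these generate. The hypotheses $\mathrm H_t^K$, $t\in[T_K]$, correspond to the sets $\mathcal M_t^K\subseteq[M_1]\times[M_2]$ of $K$ pairs in which no index of either database occurs twice, and $\mathcal P_t^K$ is the set of all tuples $(P^{M_1},Q^{M_2})$ of distributions on $\mathcal X$ with $P_i=Q_j$ if and only if $(i,j)\in\mathcal M_t^K$. A sequential test $\Phi=(\tau,\phi)$ consists of a stopping time $\tau$ of $(\mathcal F_n)_{n\ge0}$ and of decision rules $\phi_n$ that map the data at time $n$ to a hypothesis. For $(P^{M_1},Q^{M_2})\in\mathcal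 P_l^K$ its mismatch probability $\beta(\Phi|P^{M_1},Q^{M_2})$ is the probability that the test does not stop with the decision $\mathrm H_l^K$. The test is *universal with bound $N$* if $\mathsf E[\tau]\le N$ under every tuple in $\bigcup_{t\in[T_K]}\mathcal P_t^K$. **Proposed test.** Put $\mathrm{GJS}(P,Q,\alpha,\beta)=\alpha D(P\|R)+\beta D(Q\|R)$ with $R=\frac{\alpha P+\beta Q}{\alpha+\beta}$; let $\mathrm S_t^K$ at time $n$ be $\sum_{(i,j)\in\mathcal M_t^K}\mathrm{GJS}(\hat T_{X_i^{\xi_n}},\hat T_{Y_j^{\chi_n}},\alpha,\beta)$, where $\hat T$ denotes the empirical distribution; and let $$f(n)=\frac{(K+1)|\mathcal X|\log(n\alpha+2)+K|\mathcal X|\log(n\beta+2)}{n}.$$ The proposed test $\Phi_N$ stops at the first $n\ge N-1$ at which $\mathrm S_t^K\le f(n)$ for some $t$, and then decides for a hypothesis of minimal score (ties are broken arbitrarily). **Exponent.** With the Rényi divergence $D_a(P\|Q)=\frac1{a-1}\log\sum_xP(x)^aQ(x)^{1-a}\in[0,\infty]$ for $0<a<1$, let $$E_{\mathrm s}(l,K,P^{M_1},Q^{M_2})=\min_{t\ne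 l}\ \sum_{(i,j)\in\mathcal M_t^K\setminus\mathcal M_l^K}\alpha\,D_{\frac{\beta}{\alpha+\beta}}(Q_j\|P_i)$$ (with $\min\emptyset=\infty$ and $-\log 0=\infty$). **Theorem.** 1. For every $N\ge2$ the expected stopping time of $\Phi_N$ is bounded by one and the same integer under all tuples in $\bigcup_t\mathcal P_t^K$. Moreover, $\Phi_N$ is universal with bound $N$ whenever $N\ge2$ and $\alpha\big((N-2)\alpha+2\big)\ge1$; thus for all sufficiently large $N$, and for all $N\ge2$ if $\alpha\ge\frac12$. 2. For every $l\in[T_K]$ and every $(P^{M_1},Q^{M_2})\in\mathcal P_l^K$, $$\liminf_{N\to\infty}\frac{-\log\beta(\Phi_N|P^{M_1},Q^{M_2})}{N}\ge E_{\mathrm s}(l,K,P^{M_1},Q^{M_2}).$$ 3. Conversely, let $(\tilde\Phi_N)_{N\ge1}$ be sequential tests such that $\tilde\Phi_N$ is universal with bound $N$ for all sufficiently large $N$, and such that $\beta(\tilde\Phi_N|\tilde P^{M_1},\tilde Q^{M_2})\to0$ as $N\to\infty$ for every $t\in[T_K]$ and every $(\tilde P^{M_1},\tilde Q^{M_2})\in\mathcal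 P_t^K$ of full support in which the $\tilde P_i$ are pairwise distinct and the $\tilde Q_j$ are pairwise distinct. Then for every $l\in[T_K]$ and every $(P^{M_1},Q^{M_2})\in\mathcal P_l^K$ of full support, $$\limsup_{N\to\infty}\frac{-\log\beta(\tilde\Phi_N|P^{M_1},Q^{M_2})}{N}\le E_{\mathrm s}(l,K,P^{M_1},Q^{M_2}).$$ 4. Hence $E_{\mathrm s}$ is the exact optimal mismatch exponent: for every $(P^{M_1},Q^{M_2})\in\mathcal P_l^K$ of full support, $\lim_{N\to\infty}-\frac1N\log\beta(\Phi_N|P^{M_1},Q^{M_2})=E_{\mathrm s}(l,K,P^{M_1},Q^{M_2})$. -/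

import Mathlib

open MeasureTheory Filter Topology
open scoped ENNReal

namespace SeqMatching

noncomputable section

/-- The hypotheses `H_t^K`: sets of `K` pairs `(i, j)` in which no index of either database
occurs twice. -/
def Matching (M₁ M₂ K : ℕ) : Type :=
  {S : Finset (Fin M₁ × Fin M₂) // S.card = K ∧
    Set.InjOn Prod.fst (S : Set (Fin M₁ × Fin M₂)) ∧
    Set.InjOn Prod.snd (S : Set (Fin M₁ × Fin M₂))}

/-- The set of all tuples `(P, Q)` of generating distributions under the hypothesis `t`. -/
def IsGenerating {X : Type*} {M₁ M₂ K : ℕ} (t : Matching M₁ M₂ K)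
    (P : Fin M₁ → PMF X) (Q : Fin M₂ → PMF X) : Prop :=
  ∀ i j, P i = Q j ↔ (i, j) ∈ t.1

/-- All distributions of the tuple have full support. -/
def FullSupport {X : Type*} {M₁ M₂ : ℕ} (P : Fin M₁ → PMF X) (Q : Fin M₂ → PMF X) : Prop :=
  (∀ i x, P i x ≠ 0) ∧ (∀ j x, Q j x ≠ 0)

/-! ### The sampling model -/

/-- A realization of all infinite sequences: `ω (Sum.inl i, k)` is the `k`-th symbol of the
`i`-th sequence of the first database and `ω (Sum.inr j, k)` is the `k`-th symbol of the `j`-th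
sequence of the second one (symbols are counted from `0`). -/
abbrev Path (X : Type*) (M₁ M₂ : ℕ) : Type _ := (Fin M₁ ⊕ Fin M₂) × ℕ → X

/-- Joint law of all sequences: independent symbols, the sequences being i.i.d. from `P i` and
`Q j` respectively. -/
def law {X : Type*} [MeasurableSpace X] {M₁ M₂ : ℕ} (P : Fin M₁ → PMF X) (Q : Fin M₂ → PMF X) :
    Measure (Path X M₁ M₂) :=
  Measure.infinitePi fun p : (Fin M₁ ⊕ Fin M₂) × ℕ => (Sum.elim P Q p.1).toMeasure

/-- Length of the sequences at time `n`: `⌈a n⌉`. -/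
def len (a : ℝ) (n : ℕ) : ℕ := ⌈a * n⌉₊

/-- The two databases available at time `n`. -/
abbrev Data (X : Type*) (M₁ M₂ : ℕ) (α β : ℝ) (n : ℕ) : Type _ :=
  (Fin M₁ → Fin (len α n) → X) × (Fin M₂ → Fin (len β n) → X)

/-- The databases observed at time `n` on a realization. -/
def obs {X : Type*} {M₁ M₂ : ℕ} (α β : ℝ) (n : ℕ) (ω : Path X M₁ M₂) : Data X M₁ M₂ α β n :=
  (fun i k => ω (Sum.inl i, k), fun j k => ω (Sum.inr j, k))

lemma len_mono (a : ℝ) : Monotone (len a) := by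
  intro m n h
  rcases le_total 0 a with ha | ha
  · exact Nat.ceil_mono (mul_le_mul_of_nonneg_left (by exact_mod_cast h) ha)
  · have h0 : len a m = 0 := Nat.ceil_eq_zero.2 (mul_nonpos_of_nonpos_of_nonneg ha (by positivity))
    rw [h0]
    exact Nat.zero_le _

lemma measurable_obs {X : Type*} [MeasurableSpace X] {M₁ M₂ : ℕ} (α β : ℝ) (n : ℕ) :
    Measurable (obs (X := X) (M₁ := M₁) (M₂ := M₂) α β n) := by
  unfold obs
  fun_prop

/-- The filtration `F_n` generated by the databases at time `n`. -/
def obsFiltration (X : Type*) [MeasurableSpace X] (M₁ M₂ : ℕ) (α β : ℝ) :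
    Filtration ℕ (inferInstance : MeasurableSpace (Path X M₁ M₂)) where
  seq n := MeasurableSpace.comap (obs α β n) inferInstance
  mono' := by
    intro m n h
    have hr : (obs (X := X) (M₁ := M₁) (M₂ := M₂) α β m) =
        (fun d : Data X M₁ M₂ α β n =>
          ((fun i k => d.1 i (Fin.castLE (len_mono α h) k),
            fun j k => d.2 j (Fin.castLE (len_mono β h) k)) : Data X M₁ M₂ α β m)) ∘
          obs α β n := rfl
    have hm : Measurable (fun d : Data X M₁ M₂ α β n =>
          ((fun i k => d.1 i (Fin.castLE (len_mono α h) k),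
            fun j k => d.2 j (Fin.castLE (len_mono β h) k)) : Data X M₁ M₂ α β m)) := by
      fun_prop
    change MeasurableSpace.comap (obs α β m) inferInstance ≤ _
    rw [hr, ← MeasurableSpace.comap_comp]
    exact MeasurableSpace.comap_mono hm.comap_le
  le' n := (measurable_obs α β n).comap_le

/-! ### Sequential tests -/

/-- A sequential test: a stopping time of the filtration of the observations, and for each time
`n` a decision rule that is applied to the databases at time `n` when the test stops at `n`. -/
structure SeqTest (X : Type*) [MeasurableSpace X] (M₁ M₂ K : ℕ) (α β : ℝ) where
  /-- the stopping time -/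
  τ : Path X M₁ M₂ → ℕ∞
  /-- it is adapted to the observations -/
  isStoppingTime : IsStoppingTime (obsFiltration X M₁ M₂ α β) τ
  /-- the decision rules -/
  φ : ∀ n : ℕ, Data X M₁ M₂ α β n → Matching M₁ M₂ K

section

variable {X : Type*} [MeasurableSpace X] {M₁ M₂ K : ℕ} {α β : ℝ}

/-- Expected stopping time under the generating distributions `(P, Q)`. -/
def SeqTest.expectedTime (Φ : SeqTest X M₁ M₂ K α β) (P : Fin M₁ → PMF X) (Q : Fin M₂ → PMF X) :
    ℝ≥0∞ :=
  ∫⁻ ω, ((Φ.τ ω : ℕ∞) : ℝ≥0∞) ∂(law P Q)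

/-- Expected stopping time universality with the bound `N`: under every hypothesis and every
tuple of generating distributions, the expected stopping time is at most `N`. -/
def SeqTest.IsUniversal (Φ : SeqTest X M₁ M₂ K α β) (N : ℕ) : Prop :=
  ∀ (t : Matching M₁ M₂ K) (P : Fin M₁ → PMF X) (Q : Fin M₂ → PMF X),
    IsGenerating t P Q → Φ.expectedTime P Q ≤ N

/-- Mismatch probability when `l` is the true hypothesis: the probability that the test does not
stop with the decision `l` (a realization on which it never stops counts as a mismatch). -/
def SeqTest.mismatchProb (Φ : SeqTest X M₁ M₂ K α β) (l : Matching M₁ M₂ K)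
    (P : Fin M₁ → PMF X) (Q : Fin M₂ → PMF X) : ℝ≥0∞ :=
  law P Q {ω | ¬ ∃ n : ℕ, Φ.τ ω = n ∧ Φ.φ n (obs α β n ω) = l}

/-- The normalized exponent `- log β(Φ | P, Q) / N`, with `- log 0 = ∞`. -/
def SeqTest.mismatchRate (Φ : SeqTest X M₁ M₂ K α β) (N : ℕ) (l : Matching M₁ M₂ K)
    (P : Fin M₁ → PMF X) (Q : Fin M₂ → PMF X) : EReal :=
  -(ENNReal.log (Φ.mismatchProb l P Q)) / (N : EReal)

end

/-! ### Scoring functions and the proposed test -/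

/-- Empirical distribution of a string. -/
def empDist {X : Type*} {n : ℕ} (x : Fin n → X) (a : X) : ℝ :=
  (Nat.card {k : Fin n // x k = a} : ℝ) / n

/-- Kullback-Leibler divergence of mass functions `P ≪ R` on a finite alphabet
(the convention `0 log 0 = 0` is automatic). -/
def klSum {X : Type*} [Fintype X] (P R : X → ℝ) : ℝ := ∑ x, P x * Real.log (P x / R x)

/-- Generalized Jensen-Shannon divergence: both mass functions are compared with their mixture
`(α P + β Q) / (α + β)`, which dominates them. -/
def GJS {X : Type*} [Fintype X] (P Q : X → ℝ) (α β : ℝ) : ℝ :=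
  α * klSum P (fun x => (α * P x + β * Q x) / (α + β)) +
    β * klSum Q (fun x => (α * P x + β * Q x) / (α + β))

/-- The scoring function `S_t^K` of the databases at time `n`. -/
def score {X : Type*} [Fintype X] {M₁ M₂ K : ℕ} {α β : ℝ} {n : ℕ} (t : Matching M₁ M₂ K)
    (d : Data X M₁ M₂ α β n) : ℝ :=
  ∑ p ∈ t.1, GJS (empDist (d.1 p.1)) (empDist (d.2 p.2)) α β

/-- The threshold `f(n)`, for an alphabet of `c` symbols. -/
def threshold (c K : ℕ) (α β : ℝ) (n : ℕ) : ℝ :=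
  ((K + 1) * c * Real.log (n * α + 2) + K * c * Real.log (n * β + 2)) / n

/-- The test `Φ` is the proposed sequential test with parameter `N`: it stops at the first time
`n ≥ N - 1` at which some score is at most `f(n)` (at `∞` if there is none), and then decides for
a matching of minimal score; ties may be broken in any way. -/
def IsProposedTest {X : Type*} [Fintype X] [MeasurableSpace X] {M₁ M₂ K : ℕ} {α β : ℝ}
    (Φ : SeqTest X M₁ M₂ K α β) (N : ℕ) : Prop :=
  (∀ ω, Φ.τ ω = ⨅ (n : ℕ) (_ : N - 1 ≤ n ∧ ∃ t : Matching M₁ M₂ K,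
      score t (obs α β n ω) ≤ threshold (Fintype.card X) K α β n), (n : ℕ∞)) ∧
  (∀ (ω : Path X M₁ M₂) (n : ℕ), Φ.τ ω = n → ∀ t : Matching M₁ M₂ K,
      score (Φ.φ n (obs α β n ω)) (obs α β n ω) ≤ score t (obs α β n ω))

/-! ### The exponent -/

/-- Rényi divergence of order `a > 0` on a finite alphabet, with values in `[0, ∞]`. -/
def renyiDiv {X : Type*} [Fintype X] [MeasurableSpace X] (a : ℝ) (P Q : PMF X) : EReal :=
  if a = 1 then ((InformationTheory.klDiv P.toMeasure Q.toMeasure : ℝ≥0∞) : EReal)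
  else ((1 / (a - 1) : ℝ) : EReal) * ENNReal.log (∑ x, P x ^ a * Q x ^ (1 - a))

/-- The exponent `E_s(l, K, P, Q)`; the minimum over the other matchings is `∞` if `l` is the
only matching. -/
def exponent {X : Type*} [Fintype X] [MeasurableSpace X] {M₁ M₂ K : ℕ} (α β : ℝ)
    (l : Matching M₁ M₂ K) (P : Fin M₁ → PMF X) (Q : Fin M₂ → PMF X) : EReal :=
  ⨅ (t : Matching M₁ M₂ K) (_ : t ≠ l),
    ∑ p ∈ t.1 \ l.1, (α : EReal) * renyiDiv (β / (α + β)) (Q p.2) (P p.1)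

end

end SeqMatching

open SeqMatching

/-!
The proposed test is analysed by the method of types, the converse by a change of measure.

*Stopping time.* If `l` is true and `(i, j)` is matched by `l`, then the strings `X_i` and `Y_j`
come from one source, and multiplying their likelihood by `exp (n GJS)` gives at most their maximum
likelihood over all memoryless sources (`GJS_le`). Maximum likelihoods sum up to at most the
number of types (`sum_prod_empDist_le`), so `exp (n S_l)` has polynomial expectation, and Markov's
inequality gives `P(S_l > f(n)) ≤ (n α + 2) ^ (-|X|)` (`law_threshold_lt_score_le`). For `|X| ≥ 2`
these tails are bounded by a telescoping sum; for `|X| = 1` all scores vanish.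

*Achievability.* A mismatch requires `S_t ≤ f(n)` for some `t ≠ l` and some `n ≥ N - 1`, hence
`GJS ≤ f(n)` for each of the independent pairs in `t \ l`. As `f(n)` tends to zero, a Pinsker type
inequality (`sq_sub_le_GJS`) makes the two types nearly equal, and for such strings the likelihood
under `P_i` and `Q_j` is at most about `(∑ P_i^u Q_j^v) ^ (n (α + β))` times their likelihood under
the tilted distribution proportional to `P_i^u Q_j^v`, where `u = α / (α + β)` and
`v = β / (α + β)` (`prod_mul_prod_le_tilted`). Summing over the strings gives the Rényi exponent
(`eventually_sum_GJS_le`). Distributions without full support are first raised to a positive level;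
normalization is not needed for the bound.

*Converse.* For `t ≠ l` the distributions of the pairs in `t` are replaced by the tilted ones, and
all distributions are perturbed slightly such that `t` is true and the distributions within each
database differ (`exists_alternative`). Under this alternative the test decides for `t` with
probability close to one in expected time at most `N`. By Wald's identity
(`integral_stoppedLogRatio`) the relative entropy of the stopped observations with respect to the
true distributions is about `N` times the term of `t` in the exponent, and a log-sum inequality
(`mul_exp_le_setIntegral_exp_neg`) turns this into a lower bound on the probability of the wrong
decision `t` under the true distributions. Horizons `m` are finite throughout, so that only finite
sums and bounded stopping times occur.
-/

namespace SeqMatching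

/-! ### The law of the sequences -/

/-- Law of a family of independent sequences, the `s`-th one being i.i.d. from `D s`. -/
noncomputable def seqLaw {S X : Type*} [MeasurableSpace X] (D : S → PMF X) :
    Measure (S × ℕ → X) :=
  Measure.infinitePi fun p : S × ℕ => (D p.1).toMeasure

lemma law_eq_seqLaw {X : Type*} [MeasurableSpace X] {M₁ M₂ : ℕ} (P : Fin M₁ → PMF X)
    (Q : Fin M₂ → PMF X) : law P Q = seqLaw (Sum.elim P Q) := rfl

instance {S X : Type*} [MeasurableSpace X] (D : S → PMF X) : IsProbabilityMeasure (seqLaw D) := by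
  unfold seqLaw; infer_instance

instance {X : Type*} [MeasurableSpace X] {M₁ M₂ : ℕ} (P : Fin M₁ → PMF X)
    (Q : Fin M₂ → PMF X) : IsProbabilityMeasure (law P Q) := by
  unfold law; infer_instance

section

variable {S X : Type*} [MeasurableSpace X]

/-- A function of finitely many symbols is integrated by a finite sum. -/
lemma lintegral_comp_coords [Finite X] [MeasurableSingletonClass X] (D : S → PMF X)
    {A : Type*} [Fintype A] [Fintype (A → X)] (f : A → S × ℕ) (hf : Function.Injective f)
    (G : (A → X) → ℝ≥0∞) :
    ∫⁻ ω, G (fun a => ω (f a)) ∂(seqLaw D) = ∑ z, G z * ∏ a, D (f a).1 (z a) := by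
  have h := Measure.map_infinitePi_infinitePi_of_inj
    (P := fun p : S × ℕ => (D p.1).toMeasure) hf
  have hm : Measurable fun (ω : S × ℕ → X) (a : A) => ω (f a) := by fun_prop
  have hG : Measurable G := measurable_of_countable G
  rw [← lintegral_map (f := G) hG hm]
  unfold seqLaw
  rw [h, lintegral_fintype]
  refine Finset.sum_congr rfl fun z _ => ?_
  rw [Measure.infinitePi_singleton_of_fintype]
  congr 1
  exact Finset.prod_congr rfl fun a _ =>
    PMF.toMeasure_apply_singleton _ _ (measurableSet_singleton _)

/-- The sequences are independent. -/
lemma iIndepFun_rows (D : S → PMF X) :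
    ProbabilityTheory.iIndepFun (fun (s : S) (ω : S × ℕ → X) (k : ℕ) => ω (s, k)) (seqLaw D) := by
  have h1 := Measure.infinitePi_map_curry (fun (s : S) (_ : ℕ) => (D s).toMeasure)
  rw [ProbabilityTheory.iIndepFun_iff_map_fun_eq_infinitePi_map (by fun_prop)]
  have h2 : ∀ s : S, (seqLaw D).map (fun ω k => ω (s, k)) =
      Measure.infinitePi fun _ : ℕ => (D s).toMeasure := fun s =>
    Measure.map_infinitePi_infinitePi_of_inj (P := fun p : S × ℕ => (D p.1).toMeasure)
      (f := fun k : ℕ => (s, k)) (fun a b h => by simpa using h)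
  simp_rw [h2]
  exact h1

/-- Functions of disjoint pairs of sequences are uncorrelated. -/
lemma lintegral_prod_pairs {I J : Type*} [Fintype I] [Fintype J] (D : I ⊕ J → PMF X)
    (t : Finset (I × J)) (h₁ : Set.InjOn Prod.fst (t : Set (I × J)))
    (h₂ : Set.InjOn Prod.snd (t : Set (I × J))) (F : I × J → (ℕ → X) → (ℕ → X) → ℝ≥0∞)
    (hF : ∀ p, Measurable (Function.uncurry (F p))) :
    ∫⁻ ω, ∏ p ∈ t, F p (fun k => ω (Sum.inl p.1, k)) (fun k => ω (Sum.inr p.2, k)) ∂(seqLaw D) =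
      ∏ p ∈ t, ∫⁻ ω, F p (fun k => ω (Sum.inl p.1, k)) (fun k => ω (Sum.inr p.2, k))
        ∂(seqLaw D) := by
  classical
  induction t using Finset.induction_on with
  | empty => simp
  | insert p t hp ih =>
    have h₁' := h₁.mono (Finset.coe_subset.2 (Finset.subset_insert p t))
    have h₂' := h₂.mono (Finset.coe_subset.2 (Finset.subset_insert p t))
    rw [Finset.prod_insert hp, ← ih h₁' h₂']
    simp_rw [Finset.prod_insert hp]
    let A : Finset (I ⊕ J) := {Sum.inl p.1, Sum.inr p.2}
    have hi := (iIndepFun_rows D).indepFun_finset A Aᶜ disjoint_compl_right (by fun_prop)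
    have e1 : ∀ q ∈ t, Sum.inl q.1 ∈ Aᶜ := fun q hq => by
      have : q.1 ≠ p.1 := fun h => hp <| by
        have := h₁ (by simp [hq]) (by simp) h
        rwa [← this]
      simp [A, this]
    have e2 : ∀ q ∈ t, Sum.inr q.2 ∈ Aᶜ := fun q hq => by
      have : q.2 ≠ p.2 := fun h => hp <| by
        have := h₂ (by simp [hq]) (by simp) h
        rwa [← this]
      simp [A, this]
    let g1 : (A → ℕ → X) → ℝ≥0∞ := fun z =>
      F p (z ⟨Sum.inl p.1, by simp [A]⟩) (z ⟨Sum.inr p.2, by simp [A]⟩)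
    let g2 : ((Aᶜ : Finset (I ⊕ J)) → ℕ → X) → ℝ≥0∞ := fun z =>
      ∏ q ∈ t.attach, F q.1 (z ⟨Sum.inl q.1.1, e1 q.1 q.2⟩) (z ⟨Sum.inr q.1.2, e2 q.1 q.2⟩)
    have hg1 : Measurable g1 := by
      have := hF p
      exact this.comp (Measurable.prodMk (by fun_prop) (by fun_prop))
    have hg2 : Measurable g2 := by
      refine Finset.measurable_prod _ fun q _ => ?_
      exact (hF q.1).comp (Measurable.prodMk (by fun_prop) (by fun_prop))
    have hi' := hi.comp hg1 hg2
    have hmeas1 : Measurable (fun (ω : (I ⊕ J) × ℕ → X) (s : A) (k : ℕ) => ω (s.1, k)) := by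
      fun_prop
    have hmeas2 : Measurable
        (fun (ω : (I ⊕ J) × ℕ → X) (s : (Aᶜ : Finset (I ⊕ J))) (k : ℕ) => ω (s.1, k)) := by
      fun_prop
    have key := ProbabilityTheory.lintegral_mul_eq_lintegral_mul_lintegral_of_indepFun''
      (hg1.comp hmeas1).aemeasurable (hg2.comp hmeas2).aemeasurable hi'
    have e3 : ∀ ω : (I ⊕ J) × ℕ → X,
        (g2 ∘ fun ω (s : (Aᶜ : Finset (I ⊕ J))) (k : ℕ) => ω (s.1, k)) ω =
        ∏ q ∈ t, F q (fun k => ω (Sum.inl q.1, k)) (fun k => ω (Sum.inr q.2, k)) := fun ω =>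
      Finset.prod_attach t
        (fun q => F q (fun k => ω (Sum.inl q.1, k)) (fun k => ω (Sum.inr q.2, k)))
    simp_rw [e3] at key
    exact key

end

section

variable {X : Type*} [Fintype X] [MeasurableSpace X] [MeasurableSingletonClass X]

/-- The joint law of initial strings of two different sequences. -/
lemma lintegral_pair {S : Type*} (D : S → PMF X) {s s' : S} (hs : s ≠ s') (a b : ℕ)
    (F : (Fin a → X) → (Fin b → X) → ℝ) (hF : ∀ x y, 0 ≤ F x y) :
    ∫⁻ ω, ENNReal.ofReal (F (fun k => ω (s, k)) (fun k => ω (s', k))) ∂(seqLaw D) =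
      ENNReal.ofReal (∑ x, ∑ y, (∏ k, (D s (x k)).toReal) * (∏ k, (D s' (y k)).toReal) *
        F x y) := by
  classical
  let f : Fin a ⊕ Fin b → S × ℕ := Sum.elim (fun k => (s, k)) (fun k => (s', k))
  have hf : Function.Injective f := by
    rintro (x | x) (y | y) h <;> simp [f, hs, hs.symm, Fin.val_inj] at h ⊢ <;> exact h
  have h := lintegral_comp_coords D f hf
    (fun z => ENNReal.ofReal (F (fun k => z (Sum.inl k)) (fun k => z (Sum.inr k))))
  simp only [f, Sum.elim_inl, Sum.elim_inr] at h
  rw [h, ENNReal.ofReal_sum_of_nonneg (fun x _ => Finset.sum_nonneg fun y _ => by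
    have := hF x y; positivity)]
  rw [← (Equiv.sumArrowEquivProdArrow (Fin a) (Fin b) X).symm.sum_comp, Fintype.sum_prod_type]
  refine Finset.sum_congr rfl fun x _ => ?_
  rw [ENNReal.ofReal_sum_of_nonneg (fun y _ => by have := hF x y; positivity)]
  refine Finset.sum_congr rfl fun y _ => ?_
  have hprod : ∀ {n : ℕ} (s : S) (x : Fin n → X),
      ENNReal.ofReal (∏ k, (D s (x k)).toReal) = ∏ k, D s (x k) := fun s x => by
    rw [ENNReal.ofReal_prod_of_nonneg (fun _ _ => ENNReal.toReal_nonneg)]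
    exact Finset.prod_congr rfl fun k _ => ENNReal.ofReal_toReal (PMF.apply_ne_top _ _)
  rw [ENNReal.ofReal_mul (by positivity), ENNReal.ofReal_mul (by positivity), hprod, hprod,
    mul_comm]
  simp [Fintype.prod_sum_type, Equiv.sumArrowEquivProdArrow]

end

/-! ### Empirical distributions and divergences -/

section

variable {X : Type*}

lemma empDist_nonneg {n : ℕ} (x : Fin n → X) (a : X) : 0 ≤ empDist x a := by
  unfold empDist; positivity

lemma empDist_apply_pos {n : ℕ} (x : Fin n → X) (k : Fin n) : 0 < empDist x (x k) := by
  have hn : 0 < n := k.pos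
  have : 0 < Nat.card {j : Fin n // x j = x k} :=
    Nat.card_pos_iff.2 ⟨⟨⟨k, rfl⟩⟩, inferInstance⟩
  unfold empDist
  positivity

lemma exists_of_empDist_ne_zero {n : ℕ} {x : Fin n → X} {a : X} (h : empDist x a ≠ 0) :
    ∃ k, x k = a := by
  by_contra! hx
  have : IsEmpty {k : Fin n // x k = a} := ⟨fun k => hx k.1 k.2⟩
  exact h (by simp [empDist])

variable [Fintype X]

lemma sum_empDist_mul {n : ℕ} (x : Fin n → X) (φ : X → ℝ) :
    ∑ a, empDist x a * φ a = (∑ k, φ (x k)) / n := by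
  classical
  rw [← Finset.sum_fiberwise_of_maps_to (t := Finset.univ) (g := x) (fun _ _ => Finset.mem_univ _),
    Finset.sum_div]
  refine Finset.sum_congr rfl fun a _ => ?_
  rw [Finset.sum_congr rfl (g := fun _ => φ a) (by
    intro k hk; rw [(Finset.mem_filter.1 hk).2]), Finset.sum_const, nsmul_eq_mul]
  unfold empDist
  rw [Nat.card_eq_fintype_card, Fintype.card_subtype]
  ring

lemma sum_empDist {n : ℕ} (hn : 0 < n) (x : Fin n → X) : ∑ a, empDist x a = 1 := by
  have h := sum_empDist_mul x (fun _ => 1)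
  have : (n : ℝ) ≠ 0 := by positivity
  simpa [this] using h

/-- The pointwise bound behind all lower bounds on divergences:
`log u ≥ 2 (1 - u ^ (-1/2))`. -/
lemma sq_sqrt_sub_le_mul_log {p r : ℝ} (hp : 0 ≤ p) (hr : 0 ≤ r) (h : r = 0 → p = 0) :
    (√p - √r) ^ 2 + p - r ≤ p * Real.log (p / r) := by
  rcases hp.eq_or_lt with rfl | hp'
  · simp [Real.sq_sqrt hr]
  have hr' : 0 < r := lt_of_le_of_ne hr fun h0 => hp'.ne' (h h0.symm)
  have hsp : 0 < √p := Real.sqrt_pos.2 hp'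
  have hsr : 0 < √r := Real.sqrt_pos.2 hr'
  have h1 : Real.log (p / r) = -2 * Real.log (√r / √p) := by
    rw [Real.log_div hp'.ne' hr'.ne', Real.log_div hsr.ne' hsp.ne', Real.log_sqrt hp,
      Real.log_sqrt hr]
    ring
  have h2 := Real.log_le_sub_one_of_pos (div_pos hsr hsp)
  have h3 : p * (√r / √p) = √p * √r := by
    field_simp
    rw [Real.sq_sqrt hp]
  have e1 := Real.sq_sqrt hp
  have e2 := Real.sq_sqrt hr
  rw [h1]
  nlinarith [mul_le_mul_of_nonneg_left h2 hp]

/-- A Pinsker type inequality. -/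
lemma sq_sub_le_klSum {p r : X → ℝ} (hp : ∀ a, 0 ≤ p a) (hr : ∀ a, 0 ≤ r a)
    (h : ∀ a, r a = 0 → p a = 0) (hp1 : ∑ a, p a = 1) (hr1 : ∑ a, r a = 1) (a : X) :
    (p a - r a) ^ 2 / 4 ≤ klSum p r := by
  have hle : ∀ {p : X → ℝ}, (∀ a, 0 ≤ p a) → ∑ a, p a = 1 → √(p a) ≤ 1 := fun hp h1 => by
    rw [Real.sqrt_le_one]
    exact h1 ▸ Finset.single_le_sum (fun b _ => hp b) (Finset.mem_univ a)
  have h1 : ∑ a, (√(p a) - √(r a)) ^ 2 ≤ klSum p r := by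
    have := Finset.sum_le_sum fun a (_ : a ∈ Finset.univ) =>
      sq_sqrt_sub_le_mul_log (hp a) (hr a) (h a)
    rw [Finset.sum_sub_distrib, Finset.sum_add_distrib, hp1, hr1] at this
    unfold klSum
    linarith
  have h2 : (√(p a) - √(r a)) ^ 2 ≤ ∑ a, (√(p a) - √(r a)) ^ 2 :=
    Finset.single_le_sum (f := fun a => (√(p a) - √(r a)) ^ 2) (fun b _ => sq_nonneg _)
      (Finset.mem_univ a)
  have e : p a - r a = (√(p a) - √(r a)) * (√(p a) + √(r a)) := by
    nlinarith [Real.sq_sqrt (hp a), Real.sq_sqrt (hr a)]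
  have h3 : (√(p a) + √(r a)) ^ 2 ≤ 4 := by
    have := hle hp hp1
    have := hle hr hr1
    have := Real.sqrt_nonneg (p a)
    have := Real.sqrt_nonneg (r a)
    nlinarith
  rw [e, mul_pow]
  nlinarith [mul_le_mul_of_nonneg_left h3 (sq_nonneg (√(p a) - √(r a)))]

lemma klSum_nonneg {p r : X → ℝ} (hp : ∀ a, 0 ≤ p a) (hr : ∀ a, 0 ≤ r a)
    (h : ∀ a, r a = 0 → p a = 0) (hp1 : ∑ a, p a = 1) (hr1 : ∑ a, r a = 1) : 0 ≤ klSum p r := by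
  rcases isEmpty_or_nonempty X with hX | ⟨⟨a⟩⟩
  · simp [klSum]
  · exact le_trans (by positivity) (sq_sub_le_klSum hp hr h hp1 hr1 a)

variable {α β : ℝ} (hα : 0 < α) (hβ : 0 < β) {p q : X → ℝ} (hp : ∀ a, 0 ≤ p a)
  (hq : ∀ a, 0 ≤ q a) (hp1 : ∑ a, p a = 1) (hq1 : ∑ a, q a = 1)

section

omit [Fintype X]

include hα hβ hp hq

lemma mixture_nonneg (a : X) : 0 ≤ (α * p a + β * q a) / (α + β) := by
  have := hp a; have := hq a; positivity

lemma left_eq_zero_of_mixture_eq_zero (a : X) (h : (α * p a + β * q a) / (α + β) = 0) :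
    p a = 0 := by
  have h1 := hp a; have h2 := hq a
  rw [div_eq_zero_iff, or_iff_left (by positivity)] at h
  have h3 : 0 ≤ α * p a := by positivity
  have h4 : 0 ≤ β * q a := by positivity
  exact (mul_eq_zero.1 (le_antisymm (by linarith) h3)).resolve_left hα.ne'

lemma right_eq_zero_of_mixture_eq_zero (a : X) (h : (α * p a + β * q a) / (α + β) = 0) :
    q a = 0 := by
  have h1 := hp a; have h2 := hq a
  rw [div_eq_zero_iff, or_iff_left (by positivity)] at h
  have h3 : 0 ≤ α * p a := by positivity
  have h4 : 0 ≤ β * q a := by positivity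
  exact (mul_eq_zero.1 (le_antisymm (by linarith) h4)).resolve_left hβ.ne'

end

include hα hβ hp1 hq1

lemma sum_mixture : ∑ a, (α * p a + β * q a) / (α + β) = 1 := by
  rw [← Finset.sum_div, Finset.sum_add_distrib, ← Finset.mul_sum, ← Finset.mul_sum, hp1, hq1]
  field_simp

include hp hq

/-- A small generalized Jensen-Shannon divergence forces the two distributions to be close. -/
lemma sq_sub_le_GJS (a : X) :
    α * (β / (α + β)) ^ 2 / 4 * (p a - q a) ^ 2 ≤ GJS p q α β := by
  have h1 := sq_sub_le_klSum hp (mixture_nonneg hα hβ hp hq)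
    (left_eq_zero_of_mixture_eq_zero hα hβ hp hq) hp1 (sum_mixture hα hβ hp1 hq1) a
  have h2 := klSum_nonneg hq (mixture_nonneg hα hβ hp hq)
    (right_eq_zero_of_mixture_eq_zero hα hβ hp hq) hq1 (sum_mixture hα hβ hp1 hq1)
  have e : p a - (α * p a + β * q a) / (α + β) = β / (α + β) * (p a - q a) := by
    field_simp
    ring
  rw [e] at h1
  unfold GJS
  nlinarith [mul_le_mul_of_nonneg_left h1 hα.le, mul_nonneg hβ.le h2]

lemma GJS_nonneg : 0 ≤ GJS p q α β := by
  rcases isEmpty_or_nonempty X with hX | ⟨⟨a⟩⟩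
  · simp [GJS, klSum]
  · exact le_trans (by positivity) (sq_sub_le_GJS hα hβ hp hq hp1 hq1 a)

/-- The mixture is the best common approximation of the two distributions. -/
lemma GJS_le {r : X → ℝ} (hr : ∀ a, 0 ≤ r a) (hr1 : ∑ a, r a = 1) (hpr : ∀ a, r a = 0 → p a = 0)
    (hqr : ∀ a, r a = 0 → q a = 0) : GJS p q α β ≤ α * klSum p r + β * klSum q r := by
  have h0 := klSum_nonneg (mixture_nonneg hα hβ hp hq) hr
    (fun a h => by rw [hpr a h, hqr a h]; simp) (sum_mixture hα hβ hp1 hq1) hr1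
  suffices h : α * klSum p r + β * klSum q r - GJS p q α β =
      (α + β) * klSum (fun a => (α * p a + β * q a) / (α + β)) r by
    nlinarith [mul_nonneg (add_pos hα hβ).le h0]
  unfold GJS klSum
  simp only [Finset.mul_sum]
  rw [← Finset.sum_add_distrib, ← Finset.sum_add_distrib, ← Finset.sum_sub_distrib]
  refine Finset.sum_congr rfl fun a _ => ?_
  set m := (α * p a + β * q a) / (α + β) with hm
  have hm' : (α + β) * m = α * p a + β * q a := by rw [hm]; field_simp
  have key : ∀ s : ℝ, (m = 0 → s = 0) → (r a = 0 → s = 0) →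
      s * Real.log (s / r a) - s * Real.log (s / m) = s * Real.log (m / r a) := fun s h1 h2 => by
    rcases eq_or_ne s 0 with rfl | hs
    · simp
    have h3 : m ≠ 0 := fun h => hs (h1 h)
    have h4 : r a ≠ 0 := fun h => hs (h2 h)
    rw [Real.log_div hs h4, Real.log_div hs h3, Real.log_div h3 h4]
    ring
  have k1 := key (p a) (left_eq_zero_of_mixture_eq_zero hα hβ hp hq a) (hpr a)
  have k2 := key (q a) (right_eq_zero_of_mixture_eq_zero hα hβ hp hq a) (hqr a)
  linear_combination α * k1 + β * k2 - Real.log (m / r a) * hm'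

end

section

variable {X : Type*} [Fintype X]

/-- The Shtarkov sum of the memoryless sources: maximized likelihoods sum up to at most the
number of types. -/
lemma sum_prod_empDist_le (n : ℕ) :
    ∑ x : Fin n → X, ∏ k, empDist x (x k) ≤ ((n : ℝ) + 1) ^ Fintype.card X := by
  classical
  let c : (Fin n → X) → X → Fin (n + 1) := fun x a =>
    ⟨Nat.card {k : Fin n // x k = a}, Nat.lt_succ_of_le <| by
      simpa using Nat.card_le_card_of_injective (Subtype.val : {k : Fin n // x k = a} → Fin n)
        Subtype.val_injective⟩
  rw [← Finset.sum_fiberwise_of_maps_to (t := Finset.univ) (g := c) (fun _ _ => Finset.mem_univ _)]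
  have h : ∀ y : X → Fin (n + 1),
      ∑ x with c x = y, ∏ k, empDist x (x k) ≤ 1 := fun y => by
    rcases (Finset.univ.filter fun x => c x = y).eq_empty_or_nonempty with he | ⟨x₀, hx₀⟩
    · rw [he]; simp
    have e : ∀ x, c x = y → ∀ a, empDist x a = empDist x₀ a := fun x hx a => by
      have := congrArg Fin.val (congrFun (hx.trans (Finset.mem_filter.1 hx₀).2.symm) a)
      simp only [c] at this
      simp only [empDist, this]
    rcases Nat.eq_zero_or_pos n with rfl | hn
    · exact (Finset.sum_le_univ_sum_of_nonneg fun x => by simp).trans (by simp)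
    calc ∑ x with c x = y, ∏ k, empDist x (x k)
        = ∑ x with c x = y, ∏ k, empDist x₀ (x k) :=
          Finset.sum_congr rfl fun x hx => Finset.prod_congr rfl fun k _ =>
            e x (Finset.mem_filter.1 hx).2 _
      _ ≤ ∑ x : Fin n → X, ∏ k, empDist x₀ (x k) :=
          Finset.sum_le_univ_sum_of_nonneg fun x => Finset.prod_nonneg fun k _ =>
            empDist_nonneg _ _
      _ = ∏ _k : Fin n, ∑ a, empDist x₀ a := (Fintype.prod_sum _).symm
      _ = 1 := by simp [sum_empDist hn]
  refine (Finset.sum_le_sum fun y _ => h y).trans ?_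
  simp

/-- The likelihood of a string, compared with its maximum over all memoryless sources. -/
lemma prod_eq_prod_empDist_mul_exp {n : ℕ} (x : Fin n → X) {r : X → ℝ}
    (hr : ∀ k, 0 < r (x k)) :
    ∏ k, r (x k) = (∏ k, empDist x (x k)) * Real.exp (-(n * klSum (empDist x) r)) := by
  rcases Nat.eq_zero_or_pos n with rfl | hn
  · simp
  have hn' : (n : ℝ) ≠ 0 := by positivity
  have h : n * klSum (empDist x) r = ∑ k, Real.log (empDist x (x k) / r (x k)) := by
    unfold klSum
    rw [sum_empDist_mul x fun a => Real.log (empDist x a / r a)]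
    field_simp
  rw [h, ← Finset.sum_neg_distrib, Real.exp_sum, ← Finset.prod_mul_distrib]
  refine Finset.prod_congr rfl fun k _ => ?_
  have := empDist_apply_pos x k
  rw [Real.exp_neg, Real.exp_log (div_pos this (hr k))]
  field_simp

end

/-! ### The expected stopping time of the proposed test -/

lemma le_len (a : ℝ) (n : ℕ) : a * n ≤ len a n := Nat.le_ceil _

lemma len_le {a : ℝ} (ha : 0 ≤ a) (n : ℕ) : (len a n : ℝ) ≤ a * n + 1 :=
  (Nat.ceil_lt_add_one (by positivity)).le

lemma len_pos {a : ℝ} (ha : 0 < a) {n : ℕ} (hn : 0 < n) : 0 < len a n :=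
  Nat.ceil_pos.2 (by positivity)

section

variable {X : Type*} [Fintype X]

/-- If both strings come from the same source, then the generalized Jensen-Shannon divergence
of their types has an exponential moment of polynomial size: by `GJS_le` the exponential factor
turns the likelihood of the two strings into at most their maximum likelihood. -/
lemma sum_exp_GJS_le {α β : ℝ} (hα : 0 < α) (hβ : 0 < β) {n : ℕ} (hn : 0 < n) {r : X → ℝ}
    (hr : ∀ a, 0 ≤ r a) (hr1 : ∑ a, r a = 1) :
    ∑ x : Fin (len α n) → X, ∑ y : Fin (len β n) → X, (∏ k, r (x k)) * (∏ k, r (y k)) *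
      Real.exp (n * GJS (empDist x) (empDist y) α β) ≤
    (n * α + 2) ^ Fintype.card X * (n * β + 2) ^ Fintype.card X := by
  have hterm : ∀ (x : Fin (len α n) → X) (y : Fin (len β n) → X),
      (∏ k, r (x k)) * (∏ k, r (y k)) * Real.exp (n * GJS (empDist x) (empDist y) α β) ≤
        (∏ k, empDist x (x k)) * ∏ k, empDist y (y k) := fun x y => by
    have hx0 : 0 ≤ ∏ k, empDist x (x k) := Finset.prod_nonneg fun k _ => empDist_nonneg _ _
    have hy0 : 0 ≤ ∏ k, empDist y (y k) := Finset.prod_nonneg fun k _ => empDist_nonneg _ _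
    by_cases hx : ∃ k, r (x k) = 0
    · obtain ⟨k, hk⟩ := hx
      rw [Finset.prod_eq_zero (Finset.mem_univ k) hk, zero_mul, zero_mul]
      positivity
    by_cases hy : ∃ k, r (y k) = 0
    · obtain ⟨k, hk⟩ := hy
      rw [Finset.prod_eq_zero (f := fun k => r (y k)) (Finset.mem_univ k) hk, mul_zero, zero_mul]
      positivity
    push Not at hx hy
    have hxr : ∀ a, r a = 0 → empDist x a = 0 := fun a ha => by
      by_contra h
      obtain ⟨k, rfl⟩ := exists_of_empDist_ne_zero h
      exact hx k ha
    have hyr : ∀ a, r a = 0 → empDist y a = 0 := fun a ha => by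
      by_contra h
      obtain ⟨k, rfl⟩ := exists_of_empDist_ne_zero h
      exact hy k ha
    have hx1 := sum_empDist (len_pos hα hn) x
    have hy1 := sum_empDist (len_pos hβ hn) y
    have h1 := GJS_le hα hβ (empDist_nonneg x) (empDist_nonneg y) hx1 hy1 hr hr1 hxr hyr
    have h2 := klSum_nonneg (empDist_nonneg x) hr hxr hx1 hr1
    have h3 := klSum_nonneg (empDist_nonneg y) hr hyr hy1 hr1
    rw [prod_eq_prod_empDist_mul_exp x fun k => lt_of_le_of_ne (hr _) (hx k).symm,
      prod_eq_prod_empDist_mul_exp y fun k => lt_of_le_of_ne (hr _) (hy k).symm]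
    set A := ∏ k, empDist x (x k)
    set B := ∏ k, empDist y (y k)
    rw [show ∀ s t u : ℝ, A * s * (B * t) * u = A * B * (s * t * u) by intros; ring,
      ← Real.exp_add, ← Real.exp_add]
    refine mul_le_of_le_one_right (mul_nonneg hx0 hy0) (Real.exp_le_one_iff.2 ?_)
    have h4 := mul_le_mul_of_nonneg_left h1 (Nat.cast_nonneg (α := ℝ) n)
    have h5 := mul_le_mul_of_nonneg_right (le_len α n) h2
    have h6 := mul_le_mul_of_nonneg_right (le_len β n) h3
    linarith
  refine (Finset.sum_le_sum fun x _ => Finset.sum_le_sum fun y _ => hterm x y).trans ?_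
  simp_rw [← Finset.mul_sum]
  rw [← Finset.sum_mul]
  have hs : ∀ {a : ℝ}, 0 < a → ∑ x : Fin (len a n) → X, ∏ k, empDist x (x k) ≤
      (n * a + 2) ^ Fintype.card X := fun {a} ha =>
    (sum_prod_empDist_le _).trans <| pow_le_pow_left₀ (by positivity)
      (by have := len_le ha.le n; linarith) _
  exact mul_le_mul (hs hα) (hs hβ)
    (Finset.sum_nonneg fun y _ => Finset.prod_nonneg fun k _ => empDist_nonneg _ _) (by positivity)

end

section

variable {X : Type*} [Fintype X] [MeasurableSpace X] [MeasurableSingletonClass X]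

omit [MeasurableSpace X] [MeasurableSingletonClass X] in
lemma PMF_sum_toReal (p : PMF X) : ∑ a, (p a).toReal = 1 := by
  rw [← ENNReal.toReal_sum fun a _ => PMF.apply_ne_top p a, ← tsum_fintype (L := .unconditional X),
    p.tsum_coe, ENNReal.toReal_one]

/-- A function of initial strings of two sequences is measurable. -/
lemma measurable_uncurry_initial {Y : Type*} [MeasurableSpace Y] (a b : ℕ)
    (G : (Fin a → X) → (Fin b → X) → Y) :
    Measurable (Function.uncurry fun (u v : ℕ → X) => G (fun k => u k) (fun k => v k)) := by
  have h : Measurable (Function.uncurry G) := measurable_of_countable _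
  have h' : Measurable fun z : (ℕ → X) × (ℕ → X) =>
      ((fun k : Fin a => z.1 k, fun k : Fin b => z.2 k) : (Fin a → X) × (Fin b → X)) := by
    fun_prop
  exact h.comp h'

variable {M₁ M₂ K : ℕ} {α β : ℝ}

/-- The score of the true matching exceeds the threshold with small probability. -/
lemma law_threshold_lt_score_le (hα : 0 < α) (hβ : 0 < β) {l : Matching M₁ M₂ K}
    {P : Fin M₁ → PMF X} {Q : Fin M₂ → PMF X} (hl : IsGenerating l P Q) {n : ℕ} (hn : 0 < n) :
    law P Q {ω | threshold (Fintype.card X) K α β n < score l (obs α β n ω)} ≤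
      ENNReal.ofReal (((n * α + 2) ^ Fintype.card X)⁻¹) := by
  set c := Fintype.card X
  set A : ℝ := n * α + 2
  set B : ℝ := n * β + 2
  have hA : 0 < A := by positivity
  have hB : 0 < B := by positivity
  have hn' : (n : ℝ) ≠ 0 := by positivity
  let F : Fin M₁ × Fin M₂ → (ℕ → X) → (ℕ → X) → ℝ≥0∞ := fun _ u v =>
    ENNReal.ofReal (Real.exp (n * GJS (empDist fun k : Fin (len α n) => u k)
      (empDist fun k : Fin (len β n) => v k) α β))
  have hscore : ∀ ω : Path X M₁ M₂, ENNReal.ofReal (Real.exp (n * score l (obs α β n ω))) =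
      ∏ p ∈ l.1, F p (fun k => ω (Sum.inl p.1, k)) (fun k => ω (Sum.inr p.2, k)) := fun ω => by
    unfold score
    rw [Finset.mul_sum, Real.exp_sum, ENNReal.ofReal_prod_of_nonneg fun _ _ => (Real.exp_pos _).le]
    rfl
  have hE : ∫⁻ ω, ENNReal.ofReal (Real.exp (n * score l (obs α β n ω))) ∂(law P Q) ≤
      ENNReal.ofReal ((A ^ c * B ^ c) ^ K) := by
    simp_rw [hscore]
    rw [law_eq_seqLaw, lintegral_prod_pairs _ _ l.2.2.1 l.2.2.2 F
      fun p => measurable_uncurry_initial _ _ fun x y =>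
        ENNReal.ofReal (Real.exp (n * GJS (empDist x) (empDist y) α β)),
      ENNReal.ofReal_pow (by positivity),
      show ENNReal.ofReal (A ^ c * B ^ c) ^ K = _ ^ l.1.card from congrArg _ l.2.1.symm]
    refine Finset.prod_le_pow_card _ _ _ fun p hp => ?_
    have hPQ : Q p.2 = P p.1 := ((hl p.1 p.2).2 hp).symm
    have := lintegral_pair (Sum.elim P Q) (s := Sum.inl p.1) (s' := Sum.inr p.2) (by simp)
      (len α n) (len β n) (fun x y => Real.exp (n * GJS (empDist x) (empDist y) α β))
      (fun _ _ => (Real.exp_pos _).le)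
    refine this.trans_le (ENNReal.ofReal_le_ofReal ?_)
    simp only [Sum.elim_inl, Sum.elim_inr, hPQ]
    exact sum_exp_GJS_le (r := fun a => (P p.1 a).toReal) hα hβ hn
      (fun _ => ENNReal.toReal_nonneg) (PMF_sum_toReal _)
  have hf : Real.exp (n * threshold c K α β n) = A ^ c * (A ^ c * B ^ c) ^ K := by
    have : n * threshold c K α β n = (c * (K + 1)) * Real.log A + (c * K) * Real.log B := by
      unfold threshold
      field_simp
      ring
    rw [this, Real.exp_add, mul_comm _ (Real.log A), mul_comm _ (Real.log B), Real.exp_mul,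
      Real.exp_mul, Real.exp_log hA, Real.exp_log hB]
    have e1 : (c : ℝ) * (K + 1) = ((c * (K + 1) : ℕ) : ℝ) := by push_cast; ring
    have e2 : (c : ℝ) * K = ((c * K : ℕ) : ℝ) := by push_cast; ring
    rw [e1, e2, Real.rpow_natCast, Real.rpow_natCast]
    ring
  have hmk := mul_meas_ge_le_lintegral₀ (μ := law P Q)
    (f := fun ω => ENNReal.ofReal (Real.exp (n * score l (obs α β n ω))))
    (((measurable_of_countable fun d : Data X M₁ M₂ α β n =>
      ENNReal.ofReal (Real.exp (n * score l d))).comp (measurable_obs α β n)).aemeasurable)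
    (ENNReal.ofReal (Real.exp (n * threshold c K α β n)))
  have hsub : law P Q {ω | threshold c K α β n < score l (obs α β n ω)} ≤
      law P Q {ω | ENNReal.ofReal (Real.exp (n * threshold c K α β n)) ≤
        ENNReal.ofReal (Real.exp (n * score l (obs α β n ω)))} := by
    refine measure_mono fun ω hω => ENNReal.ofReal_le_ofReal (Real.exp_le_exp.2 ?_)
    exact mul_le_mul_of_nonneg_left (le_of_lt hω) (Nat.cast_nonneg _)
  have h := (mul_le_mul_right hsub _).trans (hmk.trans hE)
  have hpos : 0 < Real.exp (n * threshold c K α β n) := Real.exp_pos _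
  rw [mul_comm] at h
  refine (ENNReal.le_div_iff_mul_le (Or.inl (by simpa using hpos))
    (Or.inl ENNReal.ofReal_ne_top)).2 h |>.trans ?_
  rw [← ENNReal.ofReal_div_of_pos hpos, hf]
  refine ENNReal.ofReal_le_ofReal (le_of_eq ?_)
  have : (A ^ c * B ^ c) ^ K ≠ 0 := by positivity
  field_simp

omit [MeasurableSpace X] [MeasurableSingletonClass X] in
/-- Over an alphabet with one symbol all scores vanish. -/
lemma score_eq_zero_of_subsingleton [Subsingleton X] (hα : 0 < α) (hβ : 0 < β) {n : ℕ}
    (hn : 0 < n) (t : Matching M₁ M₂ K) (d : Data X M₁ M₂ α β n) : score t d = 0 := by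
  refine Finset.sum_eq_zero fun p _ => ?_
  have h : ∀ {m : ℕ}, 0 < m → ∀ x : Fin m → X, ∀ a, empDist x a = 1 := fun hm x a => by
    rw [← sum_empDist hm x, Fintype.sum_subsingleton _ a]
  have hne : α + β ≠ 0 := by positivity
  simp [GJS, klSum, h (len_pos hα hn), h (len_pos hβ hn), hne]

end

/-! ### From tail bounds to the expectation -/

lemma toENNReal_eq_tsum (τ : ℕ∞) :
    (τ : ℝ≥0∞) = ∑' n : ℕ, if (n : ℕ∞) < τ then (1 : ℝ≥0∞) else 0 := by
  induction τ with
  | top => simp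
  | coe k =>
    rw [tsum_eq_sum (s := Finset.range k) fun n hn => by simpa using hn]
    rw [Finset.sum_congr rfl (g := fun _ => (1 : ℝ≥0∞)) fun n hn => by simpa using hn]
    simp

section

variable {X : Type*} [MeasurableSpace X] {M₁ M₂ K : ℕ} {α β : ℝ}

lemma SeqTest.measurableSet_le (Φ : SeqTest X M₁ M₂ K α β) (n : ℕ) :
    MeasurableSet {ω | Φ.τ ω ≤ n} :=
  (obsFiltration X M₁ M₂ α β).le n _ (Φ.isStoppingTime n)

lemma SeqTest.measurableSet_gt (Φ : SeqTest X M₁ M₂ K α β) (n : ℕ) :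
    MeasurableSet {ω | n < Φ.τ ω} := by
  convert (Φ.measurableSet_le n).compl using 1
  ext ω
  simp

lemma SeqTest.measurable_toENNReal (Φ : SeqTest X M₁ M₂ K α β) :
    Measurable fun ω => ((Φ.τ ω : ℕ∞) : ℝ≥0∞) := by
  simp_rw [toENNReal_eq_tsum]
  exact Measurable.tsum fun n =>
    Measurable.ite (Φ.measurableSet_gt n) measurable_const measurable_const

lemma SeqTest.expectedTime_eq_tsum (Φ : SeqTest X M₁ M₂ K α β) (P : Fin M₁ → PMF X)
    (Q : Fin M₂ → PMF X) : Φ.expectedTime P Q = ∑' n : ℕ, law P Q {ω | n < Φ.τ ω} := by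
  unfold SeqTest.expectedTime
  simp_rw [toENNReal_eq_tsum]
  rw [lintegral_tsum fun n =>
    (Measurable.ite (Φ.measurableSet_gt n) measurable_const measurable_const).aemeasurable]
  refine tsum_congr fun n => ?_
  rw [← lintegral_indicator_one (Φ.measurableSet_gt n)]
  simp only [Set.indicator_apply, Set.mem_ofPred_eq, Pi.one_apply]

end

/-- Telescoping bound for the tails of `∑ 1 / (n α + 2)²`. -/
lemma sum_range_tail_le {α : ℝ} (hα : 0 < α) (M j : ℕ) :
    ∑ n ∈ Finset.range (M + 1 + j), (if n < M + 1 then (1 : ℝ) else (((n : ℝ) * α + 2) ^ 2)⁻¹) ≤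
      M + 1 + (1 / (α * (M * α + 2)) - 1 / (α * ((M + j) * α + 2))) := by
  induction j with
  | zero =>
    rw [Finset.sum_congr rfl (g := fun _ => (1 : ℝ)) fun n hn => by
      rw [if_pos (by simpa using hn)]]
    simp
  | succ j ih =>
    rw [← add_assoc, Finset.sum_range_succ, if_neg (by omega)]
    push_cast
    have h : ((((M : ℝ) + 1 + j) * α + 2) ^ 2)⁻¹ ≤
        1 / (α * ((M + j) * α + 2)) - 1 / (α * ((M + (j + 1)) * α + 2)) := by
      have hu : 0 < (M + j) * α + 2 := by positivity
      set u := (M + j) * α + 2 with hu'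
      have e1 : ((M : ℝ) + 1 + j) * α + 2 = u + α := by rw [hu']; ring
      have e2 : ((M : ℝ) + (j + 1)) * α + 2 = u + α := by rw [hu']; ring
      rw [e1, e2]
      have e3 : 1 / (α * u) - 1 / (α * (u + α)) = 1 / (u * (u + α)) := by
        field_simp
        ring
      rw [e3, ← one_div]
      exact one_div_le_one_div_of_le (by positivity) (by nlinarith)
    linarith

section

variable {X : Type*} [Fintype X] [MeasurableSpace X] [MeasurableSingletonClass X]
  {M₁ M₂ K : ℕ} {α β : ℝ}

omit [MeasurableSingletonClass X] in
lemma IsProposedTest.threshold_lt_score {Φ : SeqTest X M₁ M₂ K α β} {N : ℕ}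
    (hΦ : IsProposedTest Φ N) {n : ℕ} (hn : N - 1 ≤ n) {ω : Path X M₁ M₂} (h : n < Φ.τ ω)
    (t : Matching M₁ M₂ K) : threshold (Fintype.card X) K α β n < score t (obs α β n ω) := by
  by_contra! hle
  rw [hΦ.1] at h
  exact absurd (iInf₂_le (f := fun (n : ℕ) (_ : N - 1 ≤ n ∧ ∃ t : Matching M₁ M₂ K,
      score t (obs α β n ω) ≤ threshold (Fintype.card X) K α β n) => (n : ℕ∞)) n ⟨hn, t, hle⟩)
    (not_le.2 h)

/-- The expected stopping time of the proposed test with parameter `M + 2`. -/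
lemma IsProposedTest.expectedTime_le (hα : 0 < α) (hβ : 0 < β) {Φ : SeqTest X M₁ M₂ K α β}
    {M : ℕ} (hΦ : IsProposedTest Φ (M + 2)) {t : Matching M₁ M₂ K}
    {P : Fin M₁ → PMF X} {Q : Fin M₂ → PMF X} (ht : IsGenerating t P Q) :
    Φ.expectedTime P Q ≤ ENNReal.ofReal (M + 1 + 1 / (α * (M * α + 2))) := by
  rw [Φ.expectedTime_eq_tsum]
  have hbound : ∀ n : ℕ, law P Q {ω | n < Φ.τ ω} ≤
      ENNReal.ofReal (if n < M + 1 then (1 : ℝ) else (((n : ℝ) * α + 2) ^ 2)⁻¹) := fun n => by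
    split_ifs with hn
    · rw [ENNReal.ofReal_one]
      exact prob_le_one
    have hn1 : M + 2 - 1 ≤ n := by omega
    have hn0 : 0 < n := by omega
    have hsub := measure_mono (μ := law P Q) fun ω (hω : ω ∈ {ω | n < Φ.τ ω}) =>
      show ω ∈ {ω | threshold (Fintype.card X) K α β n < score t (obs α β n ω)} from
        hΦ.threshold_lt_score hn1 hω t
    refine hsub.trans ?_
    rcases subsingleton_or_nontrivial X with hX | hX
    · have : {ω : Path X M₁ M₂ |
          threshold (Fintype.card X) K α β n < score t (obs α β n ω)} = ∅ := by
        ext ω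
        simp only [Set.mem_ofPred_eq, Set.mem_empty_iff_false, iff_false, not_lt]
        rw [score_eq_zero_of_subsingleton hα hβ hn0]
        have h1 : 0 ≤ Real.log (n * α + 2) := Real.log_nonneg <| by
          nlinarith [mul_nonneg (Nat.cast_nonneg (α := ℝ) n) hα.le]
        have h2 : 0 ≤ Real.log (n * β + 2) := Real.log_nonneg <| by
          nlinarith [mul_nonneg (Nat.cast_nonneg (α := ℝ) n) hβ.le]
        unfold threshold
        positivity
      rw [this]
      simp
    · refine (law_threshold_lt_score_le hα hβ ht hn0).trans (ENNReal.ofReal_le_ofReal ?_)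
      have h1 : (1 : ℝ) ≤ n * α + 2 := by
        nlinarith [mul_nonneg (Nat.cast_nonneg (α := ℝ) n) hα.le]
      exact inv_anti₀ (by positivity) (pow_le_pow_right₀ h1 Fintype.one_lt_card)
  refine (ENNReal.tsum_le_tsum hbound).trans (ENNReal.tsum_le_of_sum_range_le fun m => ?_)
  have hnn : ∀ n : ℕ, (0 : ℝ) ≤ if n < M + 1 then (1 : ℝ) else (((n : ℝ) * α + 2) ^ 2)⁻¹ :=
    fun n => by split_ifs <;> positivity
  rw [← ENNReal.ofReal_sum_of_nonneg fun n _ => hnn n]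
  refine ENNReal.ofReal_le_ofReal ?_
  refine (Finset.sum_le_sum_of_subset_of_nonneg (Finset.range_mono (by omega : m ≤ M + 1 + m))
    fun n _ _ => hnn n).trans ((sum_range_tail_le hα M m).trans ?_)
  have : 0 ≤ 1 / (α * ((M + m) * α + 2)) := by positivity
  linarith

lemma IsProposedTest.exists_isUniversal (hα : 0 < α) (hβ : 0 < β) {Φ : SeqTest X M₁ M₂ K α β}
    {N : ℕ} (hN : 2 ≤ N) (hΦ : IsProposedTest Φ N) :
    ∃ B : ℕ, Φ.IsUniversal B := by
  obtain ⟨M, rfl⟩ := Nat.exists_eq_add_of_le' hN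
  refine ⟨⌈(M + 1 + 1 / (α * (M * α + 2)) : ℝ)⌉₊, fun t P Q ht =>
    (hΦ.expectedTime_le hα hβ ht).trans ?_⟩
  rw [← ENNReal.ofReal_natCast]
  exact ENNReal.ofReal_le_ofReal (Nat.le_ceil _)

lemma IsProposedTest.isUniversal (hα : 0 < α) (hβ : 0 < β) {Φ : SeqTest X M₁ M₂ K α β}
    {N : ℕ} (hN : 2 ≤ N) (hN' : 1 ≤ α * (((N : ℝ) - 2) * α + 2)) (hΦ : IsProposedTest Φ N)
    : Φ.IsUniversal N := by
  obtain ⟨M, rfl⟩ := Nat.exists_eq_add_of_le' hN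
  intro t P Q ht
  refine (hΦ.expectedTime_le hα hβ ht).trans ?_
  rw [← ENNReal.ofReal_natCast]
  refine ENNReal.ofReal_le_ofReal ?_
  push_cast at hN' ⊢
  rw [add_sub_cancel_right] at hN'
  have := (div_le_one (by linarith)).2 hN'
  linarith

end

/-! ### The overlap of two distributions and the Rényi divergence -/

/-- The weighted overlap (Hellinger integral) `∑ p ^ (α / (α + β)) q ^ (β / (α + β))` of two
nonnegative functions, which need not be normalized. -/
noncomputable def overlap {X : Type*} [Fintype X] (α β : ℝ) (p q : X → ℝ) : ℝ :=
  ∑ a, p a ^ (α / (α + β)) * q a ^ (β / (α + β))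

section

variable {X : Type*} [Fintype X] {α β : ℝ}

lemma overlap_pos [Nonempty X] {g h : X → ℝ} (hg : ∀ a, 0 < g a) (hh : ∀ a, 0 < h a) :
    0 < overlap α β g h :=
  Finset.sum_pos (fun a _ => mul_pos (Real.rpow_pos_of_pos (hg a) _)
    (Real.rpow_pos_of_pos (hh a) _)) Finset.univ_nonempty

lemma overlap_nonneg {g h : X → ℝ} (hg : ∀ a, 0 ≤ g a) (hh : ∀ a, 0 ≤ h a) :
    0 ≤ overlap α β g h :=
  Finset.sum_nonneg fun a _ => mul_nonneg (Real.rpow_nonneg (hg a) _) (Real.rpow_nonneg (hh a) _)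

/-- Different distributions have overlap less than one (strict weighted AM-GM). -/
lemma overlap_lt_one (hα : 0 < α) (hβ : 0 < β) {p q : X → ℝ} (hp : ∀ a, 0 ≤ p a)
    (hq : ∀ a, 0 ≤ q a) (hp1 : ∑ a, p a = 1) (hq1 : ∑ a, q a = 1) (hpq : p ≠ q) :
    overlap α β p q < 1 := by
  obtain ⟨b, hb⟩ := Function.ne_iff.1 hpq
  have hw : α / (α + β) + β / (α + β) = 1 := by field_simp
  have hwa : 0 < α / (α + β) := by positivity
  have hwb : 0 < β / (α + β) := by positivity
  have : overlap α β p q < ∑ a, (α / (α + β) * p a + β / (α + β) * q a) := by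
    refine Finset.sum_lt_sum (fun a _ => Real.geom_mean_le_arith_mean2_weighted hwa.le hwb.le
      (hp a) (hq a) hw) ⟨b, Finset.mem_univ b, ?_⟩
    exact (Real.geom_mean_lt_arith_mean2_weighted_iff_of_pos hwa hwb (hp b) (hq b) hw).2 hb
  rwa [Finset.sum_add_distrib, ← Finset.mul_sum, ← Finset.mul_sum, hp1, hq1, mul_one, mul_one,
    hw] at this

lemma continuous_overlap_max (hα : 0 < α) (hβ : 0 < β) (p q : X → ℝ) :
    Continuous fun η : ℝ => overlap α β (fun a => max (p a) η) (fun a => max (q a) η) := by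
  unfold overlap
  refine continuous_finsetSum _ fun a _ => Continuous.mul ?_ ?_
  · exact (continuous_const.max continuous_id).rpow_const fun _ => Or.inr (by positivity)
  · exact (continuous_const.max continuous_id).rpow_const fun _ => Or.inr (by positivity)

lemma mul_renyiDiv [MeasurableSpace X] (hα : 0 < α) (hβ : 0 < β) (P Q : PMF X) :
    (α : EReal) * renyiDiv (β / (α + β)) Q P = ((-(α + β) : ℝ) : EReal) *
      ENNReal.log (ENNReal.ofReal
        (overlap α β (fun a => (P a).toReal) fun a => (Q a).toReal)) := by
  have h1 : β / (α + β) ≠ 1 := by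
    rw [Ne, div_eq_one_iff_eq (by positivity)]
    linarith
  have h2 : 1 - β / (α + β) = α / (α + β) := by field_simp; ring
  have h3 : α * (1 / (β / (α + β) - 1)) = -(α + β) := by
    rw [show β / (α + β) - 1 = -(α / (α + β)) by rw [← h2]; ring]
    field_simp
  have hs : ENNReal.ofReal (overlap α β (fun a => (P a).toReal) fun a => (Q a).toReal) =
      ∑ a, Q a ^ (β / (α + β)) * P a ^ (1 - β / (α + β)) := by
    unfold overlap
    rw [h2, ENNReal.ofReal_sum_of_nonneg fun a _ => by positivity]
    refine Finset.sum_congr rfl fun a _ => ?_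
    rw [ENNReal.ofReal_mul (by positivity),
      ← ENNReal.ofReal_rpow_of_nonneg ENNReal.toReal_nonneg (by positivity),
      ← ENNReal.ofReal_rpow_of_nonneg ENNReal.toReal_nonneg (by positivity),
      ENNReal.ofReal_toReal (PMF.apply_ne_top _ _), ENNReal.ofReal_toReal (PMF.apply_ne_top _ _),
      mul_comm]
  rw [renyiDiv, if_neg h1, ← hs, ← mul_assoc, ← EReal.coe_mul, h3]

lemma mul_renyiDiv_of_pos [MeasurableSpace X] (hα : 0 < α) (hβ : 0 < β) {P Q : PMF X}
    (h : 0 < overlap α β (fun a => (P a).toReal) fun a => (Q a).toReal) :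
    (α : EReal) * renyiDiv (β / (α + β)) Q P = ((-(α + β) * Real.log
      (overlap α β (fun a => (P a).toReal) fun a => (Q a).toReal) : ℝ) : EReal) := by
  rw [mul_renyiDiv hα hβ, ENNReal.log_ofReal_of_pos h, ← EReal.coe_mul]

/-- A lower bound on the Rényi divergence as an upper bound on the overlap; this form covers
distributions with disjoint supports, too. -/
lemma overlap_lt_of_lt_mul_renyiDiv [MeasurableSpace X] (hα : 0 < α) (hβ : 0 < β) {P Q : PMF X}
    {e : ℝ} (he : (e : EReal) < (α : EReal) * renyiDiv (β / (α + β)) Q P) :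
    overlap α β (fun a => (P a).toReal) (fun a => (Q a).toReal) < Real.exp (-e / (α + β)) := by
  rcases (overlap_nonneg (α := α) (β := β) (fun a => ENNReal.toReal_nonneg (a := P a))
    fun a => ENNReal.toReal_nonneg (a := Q a)).eq_or_lt with h0 | h0
  · rw [← h0]; positivity
  · rw [mul_renyiDiv_of_pos hα hβ h0, EReal.coe_lt_coe_iff] at he
    rw [← Real.log_lt_iff_lt_exp h0, lt_div_iff₀ (by positivity)]
    linarith

lemma mul_renyiDiv_pos [MeasurableSpace X] (hα : 0 < α) (hβ : 0 < β) {P Q : PMF X} (h : P ≠ Q) :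
    0 < (α : EReal) * renyiDiv (β / (α + β)) Q P := by
  rcases (overlap_nonneg (α := α) (β := β) (fun a => ENNReal.toReal_nonneg (a := P a))
    fun a => ENNReal.toReal_nonneg (a := Q a)).eq_or_lt with h0 | h0
  · rw [mul_renyiDiv hα hβ, ← h0, ENNReal.ofReal_zero, ENNReal.log_zero,
      EReal.coe_mul_bot_of_neg (by linarith)]
    exact EReal.zero_lt_top
  · have hne : (fun a => (P a).toReal) ≠ fun a => (Q a).toReal := fun h' => h <| PMF.ext fun a =>
      (ENNReal.toReal_eq_toReal_iff' (PMF.apply_ne_top _ _) (PMF.apply_ne_top _ _)).1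
        (congrFun h' a)
    have h1 := overlap_lt_one hα hβ (fun a => ENNReal.toReal_nonneg (a := P a))
      (fun a => ENNReal.toReal_nonneg (a := Q a)) (PMF_sum_toReal P) (PMF_sum_toReal Q) hne
    rw [mul_renyiDiv_of_pos hα hβ h0, ← EReal.coe_zero, EReal.coe_lt_coe_iff]
    have := Real.log_neg h0 h1
    nlinarith

/-! ### Change of measure to the tilted distribution -/

/-- The tilted distribution `g ^ (α / (α + β)) h ^ (β / (α + β)) / overlap g h`. For probability
mass functions it is the minimizer of `α D(U‖g) + β D(U‖h)`. -/
noncomputable def tilted (α β : ℝ) (g h : X → ℝ) (a : X) : ℝ :=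
  g a ^ (α / (α + β)) * h a ^ (β / (α + β)) / overlap α β g h

section

variable [Nonempty X] {g h : X → ℝ} (hg : ∀ a, 0 < g a) (hh : ∀ a, 0 < h a)

include hg hh

lemma tilted_pos (a : X) : 0 < tilted α β g h a :=
  div_pos (mul_pos (Real.rpow_pos_of_pos (hg a) _) (Real.rpow_pos_of_pos (hh a) _))
    (overlap_pos hg hh)

lemma sum_tilted : ∑ a, tilted α β g h a = 1 := by
  unfold tilted
  rw [← Finset.sum_div]
  exact div_self (overlap_pos hg hh).ne'

lemma log_tilted (a : X) : Real.log (tilted α β g h a) =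
    α / (α + β) * Real.log (g a) + β / (α + β) * Real.log (h a) -
      Real.log (overlap α β g h) := by
  have h1 := Real.rpow_pos_of_pos (hg a) (α / (α + β))
  have h2 := Real.rpow_pos_of_pos (hh a) (β / (α + β))
  rw [tilted, Real.log_div (by positivity) (overlap_pos hg hh).ne', Real.log_mul h1.ne' h2.ne',
    Real.log_rpow (hg a), Real.log_rpow (hh a)]

/-- The tilted distribution attains the Rényi divergence. -/
lemma klSum_tilted (hα : 0 < α) (hβ : 0 < β) :
    α * klSum (tilted α β g h) g + β * klSum (tilted α β g h) h =
      -(α + β) * Real.log (overlap α β g h) := by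
  have e : -(α + β) * Real.log (overlap α β g h) =
      ∑ a, tilted α β g h a * (-(α + β) * Real.log (overlap α β g h)) := by
    rw [← Finset.sum_mul, sum_tilted hg hh, one_mul]
  rw [e]
  unfold klSum
  rw [Finset.mul_sum, Finset.mul_sum, ← Finset.sum_add_distrib]
  refine Finset.sum_congr rfl fun a _ => ?_
  rw [Real.log_div (tilted_pos hg hh a).ne' (hg a).ne',
    Real.log_div (tilted_pos hg hh a).ne' (hh a).ne', log_tilted hg hh a]
  have : α + β ≠ 0 := by positivity
  field_simp
  ring

end

lemma klSum_self {g : X → ℝ} (hg : ∀ a, 0 < g a) : klSum g g = 0 :=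
  Finset.sum_eq_zero fun a _ => by rw [div_self (hg a).ne', Real.log_one, mul_zero]

lemma overlap_self (hα : 0 < α) (hβ : 0 < β) {g : X → ℝ} (hg : ∀ a, 0 < g a)
    (hg1 : ∑ a, g a = 1) : overlap α β g g = 1 := by
  rw [← hg1]
  refine Finset.sum_congr rfl fun a _ => ?_
  have : α / (α + β) + β / (α + β) = 1 := by field_simp
  rw [← Real.rpow_add (hg a), this, Real.rpow_one]

/-- If the types of `x` and `y` are close, then the likelihood of the two strings under `g` and
`h` is, up to a subexponential factor, `overlap g h ^ (n (α + β))` times their likelihood under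
the tilted distribution, used for both. -/
lemma prod_mul_prod_le_tilted [Nonempty X] (hα : 0 < α) (hβ : 0 < β) {g h : X → ℝ}
    (hg : ∀ a, 0 < g a) (hh : ∀ a, 0 < h a) {n : ℕ} (hn : 0 < n) {δ : ℝ}
    (x : Fin (len α n) → X) (y : Fin (len β n) → X)
    (hxy : ∀ a, |empDist x a - empDist y a| ≤ δ) :
    (∏ k, g (x k)) * ∏ k, h (y k) ≤
      Real.exp (n * ((α + β) * Real.log (overlap α β g h)) +
        n * (α * β / (α + β) * δ * ∑ a, |Real.log (g a) - Real.log (h a)|) +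
        (2 * |Real.log (overlap α β g h)| + ∑ a, |Real.log (g a) - Real.log (h a)|)) *
      ((∏ k, tilted α β g h (x k)) * ∏ k, tilted α β g h (y k)) := by
  have hlogU := log_tilted (α := α) (β := β) hg hh
  have hUpos := tilted_pos (α := α) (β := β) hg hh
  set U := tilted α β g h
  set B := overlap α β g h with hB
  have hB0 : 0 < B := overlap_pos hg hh
  set u := α / (α + β) with hu
  set v := β / (α + β) with hv
  have hu0 : 0 < u := by positivity
  have hv0 : 0 < v := by positivity
  have huv : u + v = 1 := by rw [hu, hv]; field_simp
  set r : X → ℝ := fun a => Real.log (g a) - Real.log (h a) with hr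
  have hprod : ∀ {m : ℕ} (z : Fin m → X) (w : X → ℝ), (∀ a, 0 < w a) → 0 < m →
      ∏ k, w (z k) = Real.exp (m * ∑ a, empDist z a * Real.log (w a)) := fun {m} z w hw hm => by
    rw [sum_empDist_mul, mul_div_cancel₀ _ (by positivity), Real.exp_sum]
    exact Finset.prod_congr rfl fun k _ => (Real.exp_log (hw _)).symm
  have hξ := len_pos hα hn
  have hχ := len_pos hβ hn
  rw [hprod x g hg hξ, hprod y h hh hχ, hprod x U hUpos hξ, hprod y U hUpos hχ, ← Real.exp_add,
    ← Real.exp_add, ← Real.exp_add, Real.exp_le_exp]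
  obtain ⟨θ, hθ⟩ : ∃ θ : ℝ, θ = len α n - α * n := ⟨_, rfl⟩
  obtain ⟨θ', hθ'⟩ : ∃ θ : ℝ, θ = len β n - β * n := ⟨_, rfl⟩
  have hθ0 : 0 ≤ θ := by have := le_len α n; linarith
  have hθ1 : θ ≤ 1 := by have := len_le hα.le n; linarith
  have hθ0' : 0 ≤ θ' := by have := le_len β n; linarith
  have hθ1' : θ' ≤ 1 := by have := len_le hβ.le n; linarith
  have eξ : (len α n : ℝ) = α * n + θ := by linarith
  have eχ : (len β n : ℝ) = β * n + θ' := by linarith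
  have hT : ∀ {m : ℕ}, 0 < m → ∀ (z : Fin m → X) a, empDist z a ≤ 1 := fun hm z a => by
    rw [← sum_empDist hm z]
    exact Finset.single_le_sum (fun b _ => empDist_nonneg z b) (Finset.mem_univ a)
  have hx1 := sum_empDist hξ x
  have hy1 := sum_empDist hχ y
  -- The log-likelihood ratio splits into a constant part and a part that sees only the
  -- difference of the two types.
  have key : (len α n : ℝ) * ∑ a, empDist x a * Real.log (g a) +
      len β n * ∑ a, empDist y a * Real.log (h a) -
      (len α n * ∑ a, empDist x a * Real.log (U a) +
        len β n * ∑ a, empDist y a * Real.log (U a)) =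
      (len α n + len β n) * Real.log B +
        ∑ a, r a * (n * (α * β / (α + β)) * (empDist x a - empDist y a) +
          (v * θ * empDist x a - u * θ' * empDist y a)) := by
    have e : ((len α n : ℝ) + len β n) * Real.log B =
        ∑ a, (len α n * empDist x a + len β n * empDist y a) * Real.log B := by
      rw [← Finset.sum_mul, Finset.sum_add_distrib, ← Finset.mul_sum, ← Finset.mul_sum, hx1, hy1]
      ring
    rw [e]
    simp only [Finset.mul_sum]
    rw [← Finset.sum_add_distrib, ← Finset.sum_add_distrib, ← Finset.sum_sub_distrib,
      ← Finset.sum_add_distrib]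
    refine Finset.sum_congr rfl fun a _ => ?_
    rw [hlogU a, eξ, eχ]
    have e1 : α * v = α * β / (α + β) := by rw [hv]; ring
    have e2 : β * u = α * β / (α + β) := by rw [hu]; ring
    have e3 : u = 1 - v := by linarith
    simp only [hr]
    rw [← e1]
    have e4 : β * (1 - v) = α * v := by rw [← e3, e1, e2]
    rw [e3]
    linear_combination (-(n : ℝ) * empDist y a * (Real.log (g a) - Real.log (h a))) * e4
  have hbound : ∀ a, r a * (n * (α * β / (α + β)) * (empDist x a - empDist y a) +
      (v * θ * empDist x a - u * θ' * empDist y a)) ≤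
      n * (α * β / (α + β) * δ) * |r a| + |r a| := fun a => by
    have h1 : |n * (α * β / (α + β)) * (empDist x a - empDist y a)| ≤
        n * (α * β / (α + β) * δ) := by
      rw [abs_mul, abs_of_nonneg (by positivity), mul_assoc]
      exact mul_le_mul_of_nonneg_left (mul_le_mul_of_nonneg_left (hxy a) (by positivity))
        (by positivity)
    have hunit : ∀ {w t e : ℝ}, 0 ≤ w → w ≤ 1 → 0 ≤ t → t ≤ 1 → 0 ≤ e → e ≤ 1 →
        0 ≤ w * t * e ∧ w * t * e ≤ 1 := fun hw hw' ht ht' he he' =>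
      ⟨by positivity, mul_le_one₀ (mul_le_one₀ hw' ht ht') he he'⟩
    have h3 := hunit hv0.le (by linarith : v ≤ 1) hθ0 hθ1 (empDist_nonneg x a) (hT hξ x a)
    have h4 := hunit hu0.le (by linarith : u ≤ 1) hθ0' hθ1' (empDist_nonneg y a) (hT hχ y a)
    have h2 : |v * θ * empDist x a - u * θ' * empDist y a| ≤ 1 := by
      rw [abs_le]; constructor <;> linarith [h3.1, h3.2, h4.1, h4.2]
    calc _ ≤ |r a| * |n * (α * β / (α + β)) * (empDist x a - empDist y a) +
          (v * θ * empDist x a - u * θ' * empDist y a)| := by rw [← abs_mul]; exact le_abs_self _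
      _ ≤ |r a| * (n * (α * β / (α + β) * δ) + 1) :=
          mul_le_mul_of_nonneg_left ((abs_add_le _ _).trans (add_le_add h1 h2)) (abs_nonneg _)
      _ = _ := by ring
  have hsum := Finset.sum_le_sum fun a (_ : a ∈ Finset.univ) => hbound a
  rw [Finset.sum_add_distrib, ← Finset.mul_sum] at hsum
  have hlog : (len α n + len β n) * Real.log B ≤
      n * ((α + β) * Real.log B) + 2 * |Real.log B| := by
    rw [eξ, eχ]
    have h1 : θ * Real.log B ≤ |Real.log B| :=
      (mul_le_mul_of_nonneg_left (le_abs_self _) hθ0).trans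
        (mul_le_of_le_one_left (abs_nonneg _) hθ1)
    have h2 : θ' * Real.log B ≤ |Real.log B| :=
      (mul_le_mul_of_nonneg_left (le_abs_self _) hθ0').trans
        (mul_le_of_le_one_left (abs_nonneg _) hθ1')
    linarith
  linarith

/-- Large deviations of the generalized Jensen-Shannon divergence: two strings from sources with
overlap less than `exp (- e / (α + β))` have types with divergence at most `f n` with
probability at most `exp (- n e)`, if `f` tends to zero. -/
lemma eventually_sum_GJS_le (hα : 0 < α) (hβ : 0 < β) {p q : X → ℝ} (hp : ∀ a, 0 ≤ p a)
    (hq : ∀ a, 0 ≤ q a) {e : ℝ} (he : overlap α β p q < Real.exp (-e / (α + β)))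
    {f : ℕ → ℝ} (hf : Tendsto f atTop (𝓝 0)) :
    ∀ᶠ n in atTop, ∑ x : Fin (len α n) → X, ∑ y : Fin (len β n) → X,
      (∏ k, p (x k)) * (∏ k, q (y k)) *
        (if GJS (empDist x) (empDist y) α β ≤ f n then 1 else 0) ≤ Real.exp (-(n * e)) := by
  rcases isEmpty_or_nonempty X with hX | hX
  · filter_upwards [eventually_gt_atTop 0] with n hn
    have : IsEmpty (Fin (len α n) → X) := ⟨fun x => hX.false (x ⟨0, len_pos hα hn⟩)⟩
    rw [Finset.univ_eq_empty, Finset.sum_empty]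
    positivity
  -- Raising the distributions to a positive level makes the supports full.
  obtain ⟨η, hη, hηe⟩ : ∃ η : ℝ, 0 < η ∧
      overlap α β (fun a => max (p a) η) (fun a => max (q a) η) < Real.exp (-e / (α + β)) := by
    have h0 : overlap α β (fun a => max (p a) 0) (fun a => max (q a) 0) <
        Real.exp (-e / (α + β)) := by
      simpa only [max_eq_left (hp _), max_eq_left (hq _)] using he
    have h1 := (continuous_overlap_max hα hβ p q).continuousAt.eventually_lt
      (continuousAt_const (y := Real.exp (-e / (α + β)))) h0
    obtain ⟨η, h2, h3⟩ := ((h1.filter_mono nhdsWithin_le_nhds).and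
      (self_mem_nhdsWithin : Set.Ioi (0 : ℝ) ∈ 𝓝[>] 0)).exists
    exact ⟨η, h3, h2⟩
  set g : X → ℝ := fun a => max (p a) η
  set h : X → ℝ := fun a => max (q a) η
  have hg : ∀ a, 0 < g a := fun a => lt_max_of_lt_right hη
  have hh : ∀ a, 0 < h a := fun a => lt_max_of_lt_right hη
  have hB0 : 0 < overlap α β g h := overlap_pos hg hh
  set U := tilted α β g h with hU
  have hU0 : ∀ a, 0 ≤ U a := fun a => (tilted_pos hg hh a).le
  have hU1 : ∑ a, U a = 1 := sum_tilted hg hh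
  have hUs : ∀ m : ℕ, ∑ z : Fin m → X, ∏ k, U (z k) = 1 := fun m => by
    rw [← Fintype.prod_sum (fun (_ : Fin m) a => U a)]
    simp [hU1]
  set R := ∑ a, |Real.log (g a) - Real.log (h a)|
  set L := Real.log (overlap α β g h)
  have hL : (α + β) * L < -e := by
    have := (Real.log_lt_iff_lt_exp hB0).2 hηe
    rw [lt_div_iff₀ (by positivity)] at this
    linarith
  set c := α * (β / (α + β)) ^ 2 / 4 with hc
  have hc0 : 0 < c := by positivity
  have hδ : Tendsto (fun n => √(f n / c)) atTop (𝓝 0) := by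
    have := (Real.continuous_sqrt.tendsto 0).comp
      ((hf.div_const c).trans (by rw [zero_div]))
    simpa [Function.comp_def] using this
  have hexp : ∀ᶠ n : ℕ in atTop, n * ((α + β) * L) + n * (α * β / (α + β) * √(f n / c) * R) +
      (2 * |L| + R) ≤ -(n * e) := by
    have h1 : Tendsto (fun n : ℕ => (α + β) * L + e + α * β / (α + β) * √(f n / c) * R +
        (2 * |L| + R) / n) atTop (𝓝 ((α + β) * L + e + α * β / (α + β) * 0 * R + 0)) :=
      (tendsto_const_nhds.add ((hδ.const_mul _).mul_const _)).add
        (tendsto_const_div_atTop_nhds_zero_nat _)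
    have h2 : (α + β) * L + e + α * β / (α + β) * 0 * R + 0 < 0 := by
      rw [mul_zero, zero_mul]; linarith
    filter_upwards [h1.eventually_lt_const h2, eventually_gt_atTop 0] with n h3 hn
    have hn' : (0 : ℝ) < n := by positivity
    have h4 := mul_neg_of_pos_of_neg hn' h3
    have h5 : (n : ℝ) * ((2 * |L| + R) / n) = 2 * |L| + R := mul_div_cancel₀ _ hn'.ne'
    rw [mul_add, h5] at h4
    linarith
  filter_upwards [hexp, eventually_gt_atTop 0] with n hn hn0
  have hterm : ∀ (x : Fin (len α n) → X) (y : Fin (len β n) → X),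
      (∏ k, p (x k)) * (∏ k, q (y k)) *
        (if GJS (empDist x) (empDist y) α β ≤ f n then 1 else 0) ≤
      Real.exp (-(n * e)) * ((∏ k, U (x k)) * ∏ k, U (y k)) := fun x y => by
    have hUx : 0 ≤ ∏ k, U (x k) := Finset.prod_nonneg fun k _ => hU0 _
    have hUy : 0 ≤ ∏ k, U (y k) := Finset.prod_nonneg fun k _ => hU0 _
    split_ifs with hG
    · have hxy : ∀ a, |empDist x a - empDist y a| ≤ √(f n / c) := fun a => by
        refine Real.abs_le_sqrt ?_
        rw [le_div_iff₀ hc0, mul_comm]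
        exact (sq_sub_le_GJS hα hβ (empDist_nonneg x) (empDist_nonneg y)
          (sum_empDist (len_pos hα hn0) x) (sum_empDist (len_pos hβ hn0) y) a).trans hG
      rw [mul_one]
      have h1 : (∏ k, p (x k)) * (∏ k, q (y k)) ≤ (∏ k, g (x k)) * ∏ k, h (y k) :=
        mul_le_mul (Finset.prod_le_prod (fun k _ => hp _) fun k _ => le_max_left _ _)
          (Finset.prod_le_prod (fun k _ => hq _) fun k _ => le_max_left _ _)
          (Finset.prod_nonneg fun k _ => hq _) (Finset.prod_nonneg fun k _ => (hg _).le)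
      refine h1.trans ((prod_mul_prod_le_tilted hα hβ hg hh hn0 x y hxy).trans ?_)
      exact mul_le_mul_of_nonneg_right (Real.exp_le_exp.2 hn) (mul_nonneg hUx hUy)
    · rw [mul_zero]
      positivity
  refine (Finset.sum_le_sum fun x _ => Finset.sum_le_sum fun y _ => hterm x y).trans ?_
  simp_rw [← Finset.mul_sum, hUs, mul_one, hUs, mul_one]
  exact le_rfl

lemma tendsto_threshold (hα : 0 < α) (hβ : 0 < β) (c K : ℕ) :
    Tendsto (threshold c K α β) atTop (𝓝 0) := by
  have key : ∀ {a : ℝ}, 0 < a →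
      Tendsto (fun n : ℕ => Real.log (n * a + 2) / n) atTop (𝓝 0) := fun {a} ha => by
    have h1 : Tendsto (fun n : ℕ => (n : ℝ) * a + 2) atTop atTop :=
      tendsto_atTop_add_const_right _ _ (tendsto_natCast_atTop_atTop.atTop_mul_const ha)
    have h2 := (Real.tendsto_pow_log_div_mul_add_atTop a⁻¹ (-2 / a) 1 (by positivity)).comp h1
    refine h2.congr fun n => ?_
    simp only [Function.comp_apply, pow_one]
    congr 1
    field_simp
    ring
  have h := ((key hα).const_mul (((K : ℝ) + 1) * c)).add ((key hβ).const_mul ((K : ℝ) * c))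
  rw [mul_zero, mul_zero, add_zero] at h
  refine h.congr fun n => ?_
  unfold threshold
  ring

end

/-! ### Existence of the proposed test -/

instance {M₁ M₂ K : ℕ} : Finite (Matching M₁ M₂ K) := by
  unfold Matching; infer_instance

lemma Matching.nonempty {M₁ M₂ K : ℕ} (h₁ : K ≤ M₁) (h₂ : K ≤ M₂) :
    Nonempty (Matching M₁ M₂ K) := by
  classical
  refine ⟨⟨Finset.univ.image fun k : Fin K => (Fin.castLE h₁ k, Fin.castLE h₂ k), ?_, ?_, ?_⟩⟩
  · rw [Finset.card_image_of_injective _ fun a b h =>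
      Fin.castLE_injective h₁ (Prod.ext_iff.1 h).1]
    simp
  all_goals
    rintro p hp q hq h
    obtain ⟨a, -, rfl⟩ := Finset.mem_image.1 (Finset.mem_coe.1 hp)
    obtain ⟨b, -, rfl⟩ := Finset.mem_image.1 (Finset.mem_coe.1 hq)
    simp at h
    rw [h]

/-- A matching that differs from `l` contains a pair outside `l`. -/
lemma Matching.sdiff_nonempty {M₁ M₂ K : ℕ} {t l : Matching M₁ M₂ K} (h : t ≠ l) :
    (t.1 \ l.1).Nonempty := by
  rw [Finset.sdiff_nonempty]
  exact fun hs => h (Subtype.ext (Finset.eq_of_subset_of_card_le hs (by rw [t.2.1, l.2.1])))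

lemma iInf_natCast_le_iff {p : ℕ → Prop} {m : ℕ} :
    (⨅ (n : ℕ) (_ : p n), (n : ℕ∞)) ≤ m ↔ ∃ n ≤ m, p n := by
  constructor
  · intro h
    by_contra! hc
    have : ((m + 1 : ℕ) : ℕ∞) ≤ ⨅ (n : ℕ) (_ : p n), (n : ℕ∞) := le_iInf₂ fun n hn => by
      refine Nat.cast_le.2 ?_
      by_contra! hlt
      exact hc n (by omega) hn
    have := this.trans h
    rw [Nat.cast_le] at this
    omega
  · rintro ⟨n, hn, hp⟩
    exact (iInf₂_le n hp).trans (Nat.cast_le.2 hn)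

lemma of_iInf_natCast_eq {p : ℕ → Prop} {m : ℕ}
    (h : (⨅ (n : ℕ) (_ : p n), (n : ℕ∞)) = m) : p m := by
  obtain ⟨n, hn, hp⟩ := iInf_natCast_le_iff.1 h.le
  have : (m : ℕ∞) ≤ n := h ▸ iInf₂_le n hp
  rw [Nat.cast_le] at this
  rwa [le_antisymm this hn]

section

variable {X : Type*} [Fintype X] [MeasurableSpace X] [MeasurableSingletonClass X]
  {M₁ M₂ K : ℕ} {α β : ℝ}

lemma exists_isProposedTest (hK : K ≤ M₂) (hM : M₂ ≤ M₁) (N : ℕ) :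
    ∃ Φ : SeqTest X M₁ M₂ K α β, IsProposedTest Φ N := by
  have := Matching.nonempty (hK.trans hM) hK
  choose φ hφ using fun (n : ℕ) (d : Data X M₁ M₂ α β n) =>
    Finite.exists_min fun t : Matching M₁ M₂ K => score t d
  refine ⟨⟨fun ω => ⨅ (n : ℕ) (_ : N - 1 ≤ n ∧ ∃ t : Matching M₁ M₂ K,
      score t (obs α β n ω) ≤ threshold (Fintype.card X) K α β n), (n : ℕ∞), fun m => ?_, φ⟩,
    fun _ => rfl, fun ω n _ t => hφ n _ t⟩
  have h : {ω : Path X M₁ M₂ | (⨅ (n : ℕ) (_ : N - 1 ≤ n ∧ ∃ t : Matching M₁ M₂ K,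
      score t (obs α β n ω) ≤ threshold (Fintype.card X) K α β n), (n : ℕ∞)) ≤ (m : ℕ∞)} =
      ⋃ n ≤ m, {ω | N - 1 ≤ n ∧ ∃ t : Matching M₁ M₂ K,
        score t (obs α β n ω) ≤ threshold (Fintype.card X) K α β n} := by
    ext ω
    simp only [Set.mem_iUnion, Set.mem_ofPred_eq, exists_prop]
    exact iInf_natCast_le_iff
  change MeasurableSet[obsFiltration X M₁ M₂ α β m] {ω : Path X M₁ M₂ |
    (⨅ (n : ℕ) (_ : N - 1 ≤ n ∧ ∃ t : Matching M₁ M₂ K,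
      score t (obs α β n ω) ≤ threshold (Fintype.card X) K α β n), (n : ℕ∞)) ≤ (m : ℕ∞)}
  rw [h]
  refine MeasurableSet.biUnion (Set.to_countable _) fun n hn => ?_
  refine (obsFiltration X M₁ M₂ α β).mono hn _ ?_
  exact ⟨{d | N - 1 ≤ n ∧ ∃ t : Matching M₁ M₂ K,
    score t d ≤ threshold (Fintype.card X) K α β n}, Set.Finite.measurableSet (Set.toFinite _),
    rfl⟩

/-! ### The mismatch exponent of the proposed test -/

/-- A wrong matching has a score below the threshold with exponentially small probability. -/
lemma eventually_law_score_le (hα : 0 < α) (hβ : 0 < β) (t l : Matching M₁ M₂ K)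
    (P : Fin M₁ → PMF X) (Q : Fin M₂ → PMF X) (e : Fin M₁ × Fin M₂ → ℝ)
    (he : ∀ p ∈ t.1 \ l.1,
      (e p : EReal) < (α : EReal) * renyiDiv (β / (α + β)) (Q p.2) (P p.1)) :
    ∀ᶠ n : ℕ in atTop,
      law P Q {ω | score t (obs α β n ω) ≤ threshold (Fintype.card X) K α β n} ≤
        ENNReal.ofReal (Real.exp (-(n * ∑ p ∈ t.1 \ l.1, e p))) := by
  have h1 : ∀ᶠ n : ℕ in atTop, ∀ p ∈ t.1 \ l.1, ∑ x : Fin (len α n) → X, ∑ y : Fin (len β n) → X,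
      (∏ k, (P p.1 (x k)).toReal) * (∏ k, (Q p.2 (y k)).toReal) *
        (if GJS (empDist x) (empDist y) α β ≤ threshold (Fintype.card X) K α β n then 1 else 0) ≤
        Real.exp (-(n * e p)) :=
    (Finset.eventually_all _).2 fun p hp => eventually_sum_GJS_le hα hβ
      (p := fun a => (P p.1 a).toReal) (q := fun a => (Q p.2 a).toReal)
      (fun _ => ENNReal.toReal_nonneg) (fun _ => ENNReal.toReal_nonneg)
      (overlap_lt_of_lt_mul_renyiDiv hα hβ (he p hp)) (tendsto_threshold hα hβ _ K)
  filter_upwards [h1, eventually_gt_atTop 0] with n hn hn0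
  let G : (Fin (len α n) → X) → (Fin (len β n) → X) → ℝ := fun x y =>
    if GJS (empDist x) (empDist y) α β ≤ threshold (Fintype.card X) K α β n then 1 else 0
  have hG : ∀ x y, 0 ≤ G x y := fun x y => by simp only [G]; split_ifs <;> norm_num
  let F : Fin M₁ × Fin M₂ → (ℕ → X) → (ℕ → X) → ℝ≥0∞ := fun _ u v =>
    ENNReal.ofReal (G (fun k => u k) (fun k => v k))
  have hmeas : MeasurableSet {ω : Path X M₁ M₂ |
      score t (obs α β n ω) ≤ threshold (Fintype.card X) K α β n} :=
    measurable_obs α β n (t := {d | score t d ≤ threshold (Fintype.card X) K α β n})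
      (Set.Finite.measurableSet (Set.toFinite _))
  have hle : ∀ ω : Path X M₁ M₂,
      {ω : Path X M₁ M₂ | score t (obs α β n ω) ≤ threshold (Fintype.card X) K α β n}.indicator
        (1 : Path X M₁ M₂ → ℝ≥0∞) ω ≤
      ∏ p ∈ t.1 \ l.1, F p (fun k => ω (Sum.inl p.1, k)) (fun k => ω (Sum.inr p.2, k)) :=
    fun ω => by
      refine Set.indicator_apply_le' (fun hω => ?_) fun _ => bot_le
      rw [Set.mem_ofPred_eq, score] at hω
      rw [Pi.one_apply, Finset.prod_eq_one]
      intro p hp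
      have h2 : GJS (empDist ((obs α β n ω).1 p.1)) (empDist ((obs α β n ω).2 p.2)) α β ≤
          threshold (Fintype.card X) K α β n :=
        (Finset.single_le_sum (f := fun p : Fin M₁ × Fin M₂ =>
          GJS (empDist ((obs α β n ω).1 p.1)) (empDist ((obs α β n ω).2 p.2)) α β)
          (fun q _ => GJS_nonneg hα hβ (empDist_nonneg _) (empDist_nonneg _)
            (sum_empDist (len_pos hα hn0) _) (sum_empDist (len_pos hβ hn0) _))
          (Finset.mem_sdiff.1 hp).1).trans hω
      have h3 : F p (fun k => ω (Sum.inl p.1, k)) (fun k => ω (Sum.inr p.2, k)) =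
          ENNReal.ofReal (if GJS (empDist ((obs α β n ω).1 p.1))
            (empDist ((obs α β n ω).2 p.2)) α β ≤ threshold (Fintype.card X) K α β n
            then 1 else 0) := rfl
      rw [h3, if_pos h2, ENNReal.ofReal_one]
  rw [← lintegral_indicator_one hmeas]
  refine (lintegral_mono hle).trans ?_
  have hsub : ((t.1 \ l.1 : Finset _) : Set (Fin M₁ × Fin M₂)) ⊆ t.1 :=
    Finset.coe_subset.2 Finset.sdiff_subset
  rw [law_eq_seqLaw, lintegral_prod_pairs _ _ (t.2.2.1.mono hsub) (t.2.2.2.mono hsub) F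
    fun p => measurable_uncurry_initial _ _ fun x y => ENNReal.ofReal (G x y), Finset.mul_sum,
    ← Finset.sum_neg_distrib, Real.exp_sum,
    ENNReal.ofReal_prod_of_nonneg fun _ _ => (Real.exp_pos _).le]
  refine Finset.prod_le_prod' fun p hp => ?_
  have h4 := lintegral_pair (Sum.elim P Q) (s := Sum.inl p.1) (s' := Sum.inr p.2) (by simp)
    (len α n) (len β n) G hG
  exact h4.trans_le (ENNReal.ofReal_le_ofReal (hn p hp))

end

/-- A real number below a finite sum is below a sum of real numbers that are below the terms. -/
lemma exists_lt_of_lt_sum {ι : Type*} (s : Finset ι) (c : ι → EReal) :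
    ∀ {e : ℝ}, (e : EReal) < ∑ i ∈ s, c i →
      ∃ e' : ι → ℝ, (∀ i ∈ s, (e' i : EReal) < c i) ∧ e < ∑ i ∈ s, e' i := by
  classical
  induction s using Finset.induction_on with
  | empty => exact fun {e} he => ⟨0, by simp, by simpa using he⟩
  | insert j s hj ih =>
    intro e he
    rw [Finset.sum_insert hj] at he
    have h : ∃ a < c j, ∃ b < ∑ i ∈ s, c i, (e : EReal) < a + b := by
      by_contra! hc
      exact absurd (EReal.add_le_of_forall_lt hc) (not_le.2 he)
    obtain ⟨a, ha, b, hb, hab⟩ := h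
    have hbot := EReal.bot_lt_add_iff.1 (lt_of_le_of_lt bot_le hab)
    lift a to ℝ using ⟨(ha.trans_le le_top).ne, hbot.1.ne'⟩
    lift b to ℝ using ⟨(hb.trans_le le_top).ne, hbot.2.ne'⟩
    obtain ⟨e', he', hs⟩ := ih hb
    rw [← EReal.coe_add, EReal.coe_lt_coe_iff] at hab
    refine ⟨Function.update e' j a, fun i hi => ?_, ?_⟩
    · rcases Finset.mem_insert.1 hi with rfl | hi
      · simpa using ha
      · rw [Function.update_of_ne (ne_of_mem_of_not_mem hi hj)]
        exact he' i hi
    · rw [Finset.sum_insert hj, Function.update_self,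
        Finset.sum_congr rfl (g := e') fun i hi => by
          rw [Function.update_of_ne (ne_of_mem_of_not_mem hi hj)]]
      linarith

section

variable {X : Type*} [Fintype X] [MeasurableSpace X] [MeasurableSingletonClass X]
  {M₁ M₂ K : ℕ} {α β : ℝ}

omit [MeasurableSingletonClass X] in
lemma IsProposedTest.mismatchProb_le {Φ : SeqTest X M₁ M₂ K α β} {N : ℕ}
    (hΦ : IsProposedTest Φ N) (l : Matching M₁ M₂ K) (P : Fin M₁ → PMF X) (Q : Fin M₂ → PMF X)
    (hτ : law P Q {ω | Φ.τ ω = ⊤} = 0) [Fintype (Matching M₁ M₂ K)] {b : ℕ → ℝ≥0∞}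
    (hb : ∀ n, N - 1 ≤ n → ∀ t : Matching M₁ M₂ K, t ≠ l →
      law P Q {ω | score t (obs α β n ω) ≤ threshold (Fintype.card X) K α β n} ≤ b n) :
    Φ.mismatchProb l P Q ≤ Fintype.card (Matching M₁ M₂ K) * ∑' n, b (n + (N - 1)) := by
  classical
  have hsub : {ω | ¬ ∃ n : ℕ, Φ.τ ω = n ∧ Φ.φ n (obs α β n ω) = l} ⊆ {ω | Φ.τ ω = ⊤} ∪
      ⋃ (t : Matching M₁ M₂ K) (n : ℕ), {ω | t ≠ l ∧
        score t (obs α β (n + (N - 1)) ω) ≤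
          threshold (Fintype.card X) K α β (n + (N - 1))} := by
    intro ω hω
    by_cases htop : Φ.τ ω = ⊤
    · exact Or.inl htop
    obtain ⟨m, hm⟩ := ENat.ne_top_iff_exists.1 htop
    have h1 := of_iInf_natCast_eq ((hΦ.1 ω).symm.trans hm.symm)
    obtain ⟨n, rfl⟩ := Nat.exists_eq_add_of_le' h1.1
    obtain ⟨t, ht⟩ := h1.2
    refine Or.inr (Set.mem_iUnion₂.2 ⟨Φ.φ _ (obs α β _ ω), n, fun h => hω ⟨_, hm.symm, h⟩, ?_⟩)
    exact (hΦ.2 ω _ hm.symm t).trans ht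
  refine (measure_mono hsub).trans ((measure_union_le _ _).trans ?_)
  rw [hτ, zero_add]
  refine (measure_iUnion_le _).trans ?_
  rw [tsum_fintype]
  refine (Finset.sum_le_card_nsmul _ _ (∑' n, b (n + (N - 1))) fun t _ => ?_).trans
    (by rw [nsmul_eq_mul, Finset.card_univ])
  refine (measure_iUnion_le _).trans (ENNReal.tsum_le_tsum fun n => ?_)
  by_cases ht : t = l
  · simp [ht]
  · exact (measure_mono fun ω hω => hω.2).trans (hb _ (Nat.le_add_left _ _) t ht)

omit [Fintype X] [MeasurableSingletonClass X] in
lemma SeqTest.law_eq_top_of_expectedTime_ne_top {Φ : SeqTest X M₁ M₂ K α β}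
    {P : Fin M₁ → PMF X} {Q : Fin M₂ → PMF X} (h : Φ.expectedTime P Q ≠ ⊤) :
    law P Q {ω | Φ.τ ω = ⊤} = 0 := by
  have := measure_eq_top_of_lintegral_ne_top Φ.measurable_toENNReal.aemeasurable h
  simpa using this

/-- Every rate below the exponent is achieved by the proposed test. -/
lemma eventually_mismatchProb_le (hα : 0 < α) (hβ : 0 < β) {Φ : ℕ → SeqTest X M₁ M₂ K α β}
    (hΦ : ∀ N, IsProposedTest (Φ N) N) {l : Matching M₁ M₂ K} {P : Fin M₁ → PMF X}
    {Q : Fin M₂ → PMF X} (hl : IsGenerating l P Q) {e : ℝ} (he0 : 0 ≤ e)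
    (he : (e : EReal) < exponent α β l P Q) :
    ∀ᶠ N : ℕ in atTop, (Φ N).mismatchProb l P Q ≤ ENNReal.ofReal (Real.exp (-(N * e))) := by
  have := Fintype.ofFinite (Matching M₁ M₂ K)
  obtain ⟨e', he', hee'⟩ := EReal.exists_between_coe_real he
  rw [EReal.coe_lt_coe_iff] at he'
  have h1 : ∀ᶠ n : ℕ in atTop, ∀ t : Matching M₁ M₂ K, t ≠ l →
      law P Q {ω | score t (obs α β n ω) ≤ threshold (Fintype.card X) K α β n} ≤
        ENNReal.ofReal (Real.exp (-(n * e'))) := by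
    refine eventually_all.2 fun t => ?_
    by_cases htl : t = l
    · simp [htl]
    have h2 : (e' : EReal) <
        ∑ p ∈ t.1 \ l.1, (α : EReal) * renyiDiv (β / (α + β)) (Q p.2) (P p.1) :=
      hee'.trans_le (iInf₂_le t htl)
    obtain ⟨c, hc, hs⟩ := exists_lt_of_lt_sum _ _ h2
    filter_upwards [eventually_law_score_le hα hβ t l P Q c hc] with n hn _
    refine hn.trans (ENNReal.ofReal_le_ofReal (Real.exp_le_exp.2 (neg_le_neg ?_)))
    exact mul_le_mul_of_nonneg_left hs.le (Nat.cast_nonneg _)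
  obtain ⟨n₀, hn₀⟩ := eventually_atTop.1 h1
  have hgeo : ∀ N : ℕ, 1 ≤ N → (Fintype.card (Matching M₁ M₂ K) : ℝ≥0∞) *
      ∑' n : ℕ, ENNReal.ofReal (Real.exp (-(((n + (N - 1) : ℕ) : ℝ) * e'))) =
      ENNReal.ofReal (Fintype.card (Matching M₁ M₂ K) *
        (Real.exp e' * (1 - Real.exp (-e'))⁻¹) * Real.exp (-(N * e'))) := fun N hN => by
    have hr : Real.exp (-e') < 1 := by
      rw [Real.exp_lt_one_iff]; linarith
    have h3 : ∀ n : ℕ, Real.exp (-(((n + (N - 1) : ℕ) : ℝ) * e')) =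
        Real.exp e' * Real.exp (-(N * e')) * Real.exp (-e') ^ n := fun n => by
      rw [← Real.exp_nat_mul, ← Real.exp_add, ← Real.exp_add]
      congr 1
      push_cast [Nat.cast_sub hN]
      ring
    simp_rw [h3]
    rw [← ENNReal.ofReal_tsum_of_nonneg (fun n => by positivity)
      ((summable_geometric_of_lt_one (Real.exp_pos _).le hr).mul_left _), tsum_mul_left,
      tsum_geometric_of_lt_one (Real.exp_pos _).le hr, ← ENNReal.ofReal_natCast,
      ← ENNReal.ofReal_mul (Nat.cast_nonneg _)]
    congr 1
    ring
  set C : ℝ := Fintype.card (Matching M₁ M₂ K) * (Real.exp e' * (1 - Real.exp (-e'))⁻¹)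
  -- The constant is absorbed by the gap between the two rates.
  have hlim : Tendsto (fun N : ℕ => C * Real.exp (-(N * (e' - e)))) atTop (𝓝 (C * 0)) := by
    refine Tendsto.const_mul _ (Real.tendsto_exp_neg_atTop_nhds_zero.comp ?_)
    exact tendsto_natCast_atTop_atTop.atTop_mul_const (by linarith)
  rw [mul_zero] at hlim
  filter_upwards [hlim.eventually_le_const one_pos, eventually_ge_atTop (n₀ + 2)] with N hN hN2
  have hτ : law P Q {ω | (Φ N).τ ω = ⊤} = 0 := by
    obtain ⟨B, hB⟩ := (hΦ N).exists_isUniversal hα hβ (by omega)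
    exact SeqTest.law_eq_top_of_expectedTime_ne_top
      (ne_top_of_le_ne_top (ENNReal.natCast_ne_top B) (hB l P Q hl))
  refine ((hΦ N).mismatchProb_le l P Q hτ (b := fun n => ENNReal.ofReal (Real.exp (-(n * e'))))
    fun n hn t ht => hn₀ n (by omega) t ht).trans ?_
  rw [hgeo N (by omega)]
  refine ENNReal.ofReal_le_ofReal ?_
  have h4 : Real.exp (-(N * e')) = Real.exp (-(N * (e' - e))) * Real.exp (-(N * e)) := by
    rw [← Real.exp_add]; congr 1; ring
  rw [h4, ← mul_assoc]
  exact mul_le_of_le_one_left (Real.exp_pos _).le hN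

omit [Fintype X] [MeasurableSingletonClass X] in
lemma SeqTest.le_mismatchRate {Φ : SeqTest X M₁ M₂ K α β} {N : ℕ} (hN : 0 < N)
    {l : Matching M₁ M₂ K} {P : Fin M₁ → PMF X} {Q : Fin M₂ → PMF X} {e : ℝ}
    (h : Φ.mismatchProb l P Q ≤ ENNReal.ofReal (Real.exp (-(N * e)))) :
    (e : EReal) ≤ Φ.mismatchRate N l P Q := by
  have hN' : (0 : EReal) < (N : EReal) := by exact_mod_cast hN
  rw [SeqTest.mismatchRate, EReal.le_div_iff_mul_le hN' (EReal.natCast_ne_top N), EReal.le_neg]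
  refine (ENNReal.log_le_log h).trans (le_of_eq ?_)
  rw [ENNReal.log_ofReal_of_pos (Real.exp_pos _), Real.log_exp, mul_comm (N : ℝ), EReal.coe_neg,
    EReal.coe_mul]
  rfl

omit [Fintype X] [MeasurableSingletonClass X] in
lemma SeqTest.mismatchRate_le {Φ : SeqTest X M₁ M₂ K α β} {N : ℕ} (hN : 0 < N)
    {l : Matching M₁ M₂ K} {P : Fin M₁ → PMF X} {Q : Fin M₂ → PMF X} {e : ℝ}
    (h : ENNReal.ofReal (Real.exp (-(N * e))) ≤ Φ.mismatchProb l P Q) :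
    Φ.mismatchRate N l P Q ≤ (e : EReal) := by
  have hN' : (0 : EReal) < (N : EReal) := by exact_mod_cast hN
  rw [SeqTest.mismatchRate, EReal.div_le_iff_le_mul hN' (EReal.natCast_ne_top N), EReal.neg_le]
  refine (le_of_eq ?_).trans (ENNReal.log_le_log h)
  rw [ENNReal.log_ofReal_of_pos (Real.exp_pos _), Real.log_exp, EReal.coe_neg, EReal.coe_mul]
  rfl

lemma exponent_le_liminf (hα : 0 < α) (hβ : 0 < β) {Φ : ℕ → SeqTest X M₁ M₂ K α β}
    (hΦ : ∀ N, IsProposedTest (Φ N) N) {l : Matching M₁ M₂ K} {P : Fin M₁ → PMF X}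
    {Q : Fin M₂ → PMF X} (hl : IsGenerating l P Q) :
    exponent α β l P Q ≤ liminf (fun N => (Φ N).mismatchRate N l P Q) atTop := by
  refine EReal.ge_of_forall_gt_iff_ge.1 fun e he => le_liminf_of_le (by isBoundedDefault) ?_
  rcases lt_or_ge e 0 with h0 | h0
  · filter_upwards [eventually_gt_atTop 0] with N hN
    refine SeqTest.le_mismatchRate hN (prob_le_one.trans ?_)
    rw [← ENNReal.ofReal_one]
    refine ENNReal.ofReal_le_ofReal (Real.one_le_exp ?_)
    have : (0 : ℝ) ≤ N := Nat.cast_nonneg N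
    nlinarith
  · filter_upwards [eventually_mismatchProb_le hα hβ hΦ hl h0 he, eventually_gt_atTop 0]
      with N hN hN0
    exact SeqTest.le_mismatchRate hN0 hN

omit [MeasurableSingletonClass X] in
lemma exponent_pos (hα : 0 < α) (hβ : 0 < β) {l : Matching M₁ M₂ K} {P : Fin M₁ → PMF X}
    {Q : Fin M₂ → PMF X} (hl : IsGenerating l P Q) : 0 < exponent α β l P Q := by
  have hpos : ∀ t : Matching M₁ M₂ K, t ≠ l →
      0 < ∑ p ∈ t.1 \ l.1, (α : EReal) * renyiDiv (β / (α + β)) (Q p.2) (P p.1) := fun t ht => by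
    have h1 : ∀ p ∈ t.1 \ l.1, 0 < (α : EReal) * renyiDiv (β / (α + β)) (Q p.2) (P p.1) :=
      fun p hp => mul_renyiDiv_pos hα hβ fun h =>
        (Finset.mem_sdiff.1 hp).2 ((hl p.1 p.2).1 h)
    obtain ⟨p, hp⟩ := Matching.sdiff_nonempty ht
    exact (h1 p hp).trans_le (Finset.single_le_sum (f := fun p : Fin M₁ × Fin M₂ =>
      (α : EReal) * renyiDiv (β / (α + β)) (Q p.2) (P p.1)) (fun q hq => (h1 q hq).le) hp)
  unfold exponent
  rw [iInf_subtype']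
  rcases isEmpty_or_nonempty {t : Matching M₁ M₂ K // t ≠ l} with h | h
  · rw [iInf_of_empty]
    exact EReal.zero_lt_top
  · obtain ⟨t, ht⟩ := exists_eq_ciInf_of_finite (f := fun t : {t : Matching M₁ M₂ K // t ≠ l} =>
      ∑ p ∈ t.1.1 \ l.1, (α : EReal) * renyiDiv (β / (α + β)) (Q p.2) (P p.1))
    rw [← ht]
    exact hpos t.1 t.2

lemma tendsto_mismatchProb (hα : 0 < α) (hβ : 0 < β) {Φ : ℕ → SeqTest X M₁ M₂ K α β}
    (hΦ : ∀ N, IsProposedTest (Φ N) N) {l : Matching M₁ M₂ K} {P : Fin M₁ → PMF X}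
    {Q : Fin M₂ → PMF X} (hl : IsGenerating l P Q) :
    Tendsto (fun N => (Φ N).mismatchProb l P Q) atTop (𝓝 0) := by
  obtain ⟨e, he0, he⟩ := EReal.exists_between_coe_real (exponent_pos hα hβ hl)
  rw [← EReal.coe_zero, EReal.coe_lt_coe_iff] at he0
  have h1 : Tendsto (fun N : ℕ => ENNReal.ofReal (Real.exp (-(N * e)))) atTop (𝓝 0) := by
    rw [← ENNReal.ofReal_zero]
    refine ENNReal.tendsto_ofReal (Real.tendsto_exp_neg_atTop_nhds_zero.comp ?_)
    exact tendsto_natCast_atTop_atTop.atTop_mul_const he0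
  exact tendsto_of_tendsto_of_tendsto_of_le_of_le' tendsto_const_nhds h1
    (Eventually.of_forall fun _ => bot_le) (eventually_mismatchProb_le hα hβ hΦ hl he0.le he)

lemma eventually_isUniversal (hα : 0 < α) (hβ : 0 < β) {Φ : ℕ → SeqTest X M₁ M₂ K α β}
    (hΦ : ∀ N, IsProposedTest (Φ N) N) : ∀ᶠ N in atTop, (Φ N).IsUniversal N := by
  have h : Tendsto (fun N : ℕ => α * (((N : ℝ) - 2) * α + 2)) atTop atTop :=
    (tendsto_atTop_add_const_right _ _ ((tendsto_atTop_add_const_right _ (-2)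
      tendsto_natCast_atTop_atTop).atTop_mul_const hα)).const_mul_atTop hα
  filter_upwards [h.eventually_ge_atTop 1, eventually_ge_atTop 2] with N hN hN2
  exact (hΦ N).isUniversal hα hβ hN2 hN

end

/-! ### Change of measure at a stopping time -/

/-- The symbols available at time `n`, if the `s`-th sequence is observed at rate `a s`. -/
noncomputable def coords {S : Type*} [Fintype S] (a : S → ℝ) (n : ℕ) : Finset (S × ℕ) :=
  (Finset.univ.sigma fun s => Finset.range (len (a s) n)).map
    (Equiv.sigmaEquivProd S ℕ).toEmbedding

/-- The event `E` is determined by the symbols in `I`. -/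
def DeterminedBy {S X : Type*} (I : Finset (S × ℕ)) (E : Set (S × ℕ → X)) : Prop :=
  ∃ D : Set (I → X), E = {ω | (fun q : I => ω q) ∈ D}

section

variable {S X : Type*} [Fintype S] {a : S → ℝ}

lemma mem_coords {n : ℕ} {q : S × ℕ} : q ∈ coords a n ↔ q.2 < len (a q.1) n := by
  obtain ⟨s, k⟩ := q
  simp [coords, Equiv.sigmaEquivProd]

lemma coords_zero : coords a 0 = ∅ := by
  ext q
  simp [mem_coords, len]

lemma coords_mono : Monotone (coords a) := fun _ _ h _ hq =>
  mem_coords.2 ((mem_coords.1 hq).trans_le (len_mono _ h))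

lemma sum_coords (n : ℕ) (f : S → ℝ) : ∑ q ∈ coords a n, f q.1 = ∑ s, len (a s) n * f s := by
  simp [coords, Finset.sum_sigma, Equiv.sigmaEquivProd]

omit [Fintype S] in
lemma DeterminedBy.compl {I : Finset (S × ℕ)} {E : Set (S × ℕ → X)} (h : DeterminedBy I E) :
    DeterminedBy I Eᶜ := by
  obtain ⟨D, rfl⟩ := h
  exact ⟨Dᶜ, rfl⟩

omit [Fintype S] in
lemma DeterminedBy.inter {I : Finset (S × ℕ)} {E F : Set (S × ℕ → X)} (h : DeterminedBy I E)
    (h' : DeterminedBy I F) : DeterminedBy I (E ∩ F) := by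
  obtain ⟨D, rfl⟩ := h
  obtain ⟨D', rfl⟩ := h'
  exact ⟨D ∩ D', rfl⟩

omit [Fintype S] in
lemma DeterminedBy.mono {I J : Finset (S × ℕ)} (hIJ : I ⊆ J) {E : Set (S × ℕ → X)}
    (h : DeterminedBy I E) : DeterminedBy J E := by
  obtain ⟨D, rfl⟩ := h
  exact ⟨{z | (fun q : I => z ⟨q.1, hIJ q.2⟩) ∈ D}, rfl⟩

variable [Fintype X] [MeasurableSpace X] [MeasurableSingletonClass X]

omit [Fintype S] in
lemma DeterminedBy.measurableSet {I : Finset (S × ℕ)} {E : Set (S × ℕ → X)}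
    (h : DeterminedBy I E) : MeasurableSet E := by
  obtain ⟨D, rfl⟩ := h
  exact (by fun_prop : Measurable fun (ω : S × ℕ → X) (q : I) => ω q)
    (Set.Finite.measurableSet (Set.toFinite D))

/-- The log-likelihood ratio of a symbol of the `s`-th sequence. -/
noncomputable def logRatio (D' D : S → PMF X) (s : S) (x : X) : ℝ :=
  Real.log ((D' s x).toReal / (D s x).toReal)

omit [Fintype S] in
/-- Change of measure for an event that is determined by finitely many symbols. -/
lemma setLIntegral_exp_neg_logRatio {D' D : S → PMF X} (hD' : ∀ s x, D' s x ≠ 0)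
    (hD : ∀ s x, D s x ≠ 0) {I : Finset (S × ℕ)} {E : Set (S × ℕ → X)} (hE : DeterminedBy I E) :
    ∫⁻ ω in E, ENNReal.ofReal (Real.exp (-∑ q ∈ I, logRatio D' D q.1 (ω q))) ∂(seqLaw D') =
      seqLaw D E := by
  classical
  have hEm := hE.measurableSet
  obtain ⟨A, rfl⟩ := hE
  have h1 := lintegral_comp_coords D' (Subtype.val : I → S × ℕ) Subtype.val_injective
    (fun z => A.indicator (fun z => ENNReal.ofReal
      (Real.exp (-∑ q : I, logRatio D' D q.1.1 (z q)))) z)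
  have h2 := lintegral_comp_coords D (Subtype.val : I → S × ℕ) Subtype.val_injective
    (fun z => A.indicator 1 z)
  rw [← lintegral_indicator hEm, ← lintegral_indicator_one hEm]
  have e1 : ∀ ω : S × ℕ → X, {ω : S × ℕ → X | (fun q : I => ω q) ∈ A}.indicator
      (fun ω => ENNReal.ofReal (Real.exp (-∑ q ∈ I, logRatio D' D q.1 (ω q)))) ω =
      A.indicator (fun z => ENNReal.ofReal
        (Real.exp (-∑ q : I, logRatio D' D q.1.1 (z q)))) (fun q : I => ω q) := fun ω => by
    simp only [Set.indicator_apply, Set.mem_ofPred_eq]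
    rw [Finset.sum_coe_sort I fun q => logRatio D' D q.1 (ω q)]
  have e2 : ∀ ω : S × ℕ → X, {ω : S × ℕ → X | (fun q : I => ω q) ∈ A}.indicator
      (1 : (S × ℕ → X) → ℝ≥0∞) ω = A.indicator 1 (fun q : I => ω q) := fun ω => by
    simp only [Set.indicator_apply, Set.mem_ofPred_eq, Pi.one_apply]
  simp_rw [e1, e2]
  rw [h1, h2]
  refine Finset.sum_congr rfl fun z _ => ?_
  by_cases hz : z ∈ A
  · simp only [Set.indicator_of_mem hz, Pi.one_apply, one_mul]
    rw [← Finset.sum_neg_distrib, Real.exp_sum,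
      ENNReal.ofReal_prod_of_nonneg fun _ _ => (Real.exp_pos _).le, ← Finset.prod_mul_distrib]
    refine Finset.prod_congr rfl fun q _ => ?_
    have h3 : 0 < (D' q.1.1 (z q)).toReal :=
      ENNReal.toReal_pos (hD' _ _) (PMF.apply_ne_top _ _)
    have h4 : 0 < (D q.1.1 (z q)).toReal := ENNReal.toReal_pos (hD _ _) (PMF.apply_ne_top _ _)
    rw [logRatio, Real.exp_neg, Real.exp_log (by positivity),
      ← ENNReal.ofReal_toReal (PMF.apply_ne_top (D' q.1.1) (z q)),
      ← ENNReal.ofReal_mul (by positivity), ENNReal.toReal_ofReal h3.le, inv_div,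
      div_mul_cancel₀ _ h3.ne', ENNReal.ofReal_toReal (PMF.apply_ne_top _ _)]
  · simp [Set.indicator_of_notMem hz]

/-- The log-likelihood ratio of all symbols available at the random time `T ≤ m`. -/
noncomputable def stoppedLogRatio (D' D : S → PMF X) (a : S → ℝ) (m : ℕ) (T : (S × ℕ → X) → ℕ)
    (ω : S × ℕ → X) : ℝ :=
  ∑ q ∈ coords a m, {ω | q ∈ coords a (T ω)}.indicator (fun ω => logRatio D' D q.1 (ω q)) ω

omit [Fintype X] [MeasurableSpace X] [MeasurableSingletonClass X] in
lemma stoppedLogRatio_eq (D' D : S → PMF X) {m : ℕ} {T : (S × ℕ → X) → ℕ} {ω : S × ℕ → X}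
    (hT : T ω ≤ m) : stoppedLogRatio D' D a m T ω =
      ∑ q ∈ coords a (T ω), logRatio D' D q.1 (ω q) := by
  classical
  unfold stoppedLogRatio
  simp only [Set.indicator_apply, Set.mem_ofPred_eq]
  rw [← Finset.sum_filter]
  refine Finset.sum_congr ?_ fun _ _ => rfl
  ext q
  simp only [Finset.mem_filter, and_iff_right_iff_imp]
  exact fun h => coords_mono hT h

/-- Change of measure at a stopping time. -/
lemma setLIntegral_exp_neg_stoppedLogRatio {D' D : S → PMF X} (hD' : ∀ s x, D' s x ≠ 0)
    (hD : ∀ s x, D s x ≠ 0) {m : ℕ} {T : (S × ℕ → X) → ℕ} (hT : ∀ ω, T ω ≤ m)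
    {E : Set (S × ℕ → X)} (hE : ∀ n ≤ m, DeterminedBy (coords a n) (E ∩ {ω | T ω = n})) :
    ∫⁻ ω in E, ENNReal.ofReal (Real.exp (-stoppedLogRatio D' D a m T ω)) ∂(seqLaw D') =
      seqLaw D E := by
  have hU : E = ⋃ n : Fin (m + 1), E ∩ {ω | T ω = n} := by
    ext ω
    simp only [Set.mem_iUnion, Set.mem_inter_iff, Set.mem_ofPred_eq, exists_and_left]
    exact ⟨fun h => ⟨h, ⟨T ω, Nat.lt_succ_of_le (hT ω)⟩, rfl⟩, fun h => h.1⟩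
  have hdisj : Pairwise (Function.onFun Disjoint
      fun n : Fin (m + 1) => E ∩ {ω | T ω = n}) := fun i j hij =>
    Set.disjoint_left.2 fun ω hi hj => hij (Fin.ext (hi.2.symm.trans hj.2))
  have hmeas : ∀ n : Fin (m + 1), MeasurableSet (E ∩ {ω | T ω = n}) := fun n =>
    (hE n (Nat.le_of_lt_succ n.2)).measurableSet
  conv_lhs => rw [hU]
  conv_rhs => rw [hU]
  rw [lintegral_iUnion hmeas hdisj, measure_iUnion hdisj hmeas]
  refine tsum_congr fun n => ?_
  rw [← setLIntegral_exp_neg_logRatio hD' hD (hE n (Nat.le_of_lt_succ n.2))]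
  refine setLIntegral_congr_fun (hmeas n) fun ω hω => ?_
  have : T ω = n := hω.2
  rw [stoppedLogRatio_eq D' D (hT ω), this]

/-- Relative entropy of the distributions of a symbol of the `s`-th sequence. -/
noncomputable def symbolDiv (D' D : S → PMF X) (s : S) : ℝ :=
  klSum (fun x => (D' s x).toReal) fun x => (D s x).toReal

omit [MeasurableSpace X] [MeasurableSingletonClass X] [Fintype S] in
lemma symbolDiv_nonneg {D' D : S → PMF X} (hD : ∀ s x, D s x ≠ 0) (s : S) :
    0 ≤ symbolDiv D' D s :=
  klSum_nonneg (fun _ => ENNReal.toReal_nonneg) (fun _ => ENNReal.toReal_nonneg)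
    (fun x h => absurd h (ENNReal.toReal_pos (hD s x) (PMF.apply_ne_top _ _)).ne')
    (PMF_sum_toReal _) (PMF_sum_toReal _)

omit [Fintype S] in
lemma integral_symbol (D' : S → PMF X) (q : S × ℕ) (h : X → ℝ) :
    ∫ ω, h (ω q) ∂(seqLaw D') = ∑ x, (D' q.1 x).toReal * h x := by
  have h1 : (seqLaw D').map (fun ω => ω q) = (D' q.1).toMeasure :=
    Measure.infinitePi_map_eval (fun p : S × ℕ => (D' p.1).toMeasure) q
  have h2 := integral_map (μ := seqLaw D') (φ := fun ω => ω q) (f := h)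
    (measurable_pi_apply q).aemeasurable (measurable_of_countable h).aestronglyMeasurable
  rw [← h2, h1, PMF.integral_eq_sum]
  simp

omit [Fintype S] in
/-- A symbol is independent of the events that are determined by other symbols. -/
lemma integral_indicator_symbol (D' : S → PMF X) {I : Finset (S × ℕ)} {q : S × ℕ} (hq : q ∉ I)
    {E : Set (S × ℕ → X)} (hE : DeterminedBy I E) (h : X → ℝ) :
    ∫ ω, E.indicator (fun ω => h (ω q)) ω ∂(seqLaw D') =
      (seqLaw D').real E * ∑ x, (D' q.1 x).toReal * h x := by
  classical
  have hEm := hE.measurableSet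
  obtain ⟨A, rfl⟩ := hE
  have hi : ProbabilityTheory.iIndepFun (fun (q : S × ℕ) (ω : S × ℕ → X) => ω q) (seqLaw D') :=
    ProbabilityTheory.iIndepFun_infinitePi (P := fun p : S × ℕ => (D' p.1).toMeasure)
      (X := fun _ x => x) (by fun_prop)
  have hi2 := hi.indepFun_finset I {q} (Finset.disjoint_singleton_right.2 hq) (by fun_prop)
  have hi3 := hi2.comp (φ := A.indicator (1 : (I → X) → ℝ))
    (ψ := fun z : ({q} : Finset (S × ℕ)) → X => h (z ⟨q, Finset.mem_singleton_self q⟩))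
    (measurable_of_countable _) (measurable_of_countable _)
  have hm1 : Measurable fun (ω : S × ℕ → X) (i : I) => ω i := by fun_prop
  have hm2 : Measurable fun (ω : S × ℕ → X) (i : ({q} : Finset (S × ℕ))) => ω i := by fun_prop
  have h1 := hi3.integral_mul_eq_mul_integral
    ((measurable_of_countable _).comp hm1).aestronglyMeasurable
    ((measurable_of_countable _).comp hm2).aestronglyMeasurable
  rw [← integral_symbol D' q h, ← integral_indicator_one hEm]
  refine Eq.trans ?_ (h1.trans ?_)
  · refine integral_congr_ae (Eventually.of_forall fun ω => ?_)
    simp only [Set.indicator_apply, Set.mem_ofPred_eq, Pi.mul_apply, Function.comp_apply,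
      Pi.one_apply]
    split_ifs <;> simp
  · rfl

variable {D' D : S → PMF X} {m : ℕ} {T : (S × ℕ → X) → ℕ}

omit [Fintype X] [MeasurableSpace X] [MeasurableSingletonClass X] in
/-- Whether the symbol `q` is observed before stopping is determined by the symbols observed
strictly before `q`. -/
lemma exists_determinedBy (hT : ∀ n, DeterminedBy (coords a n) {ω : S × ℕ → X | T ω ≤ n})
    {q : S × ℕ} (hq : q ∈ coords a m) :
    ∃ n, q ∉ coords a n ∧ DeterminedBy (coords a n) {ω : S × ℕ → X | q ∈ coords a (T ω)} := by
  classical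
  have hex : ∃ n, q ∈ coords a n := ⟨m, hq⟩
  obtain ⟨n, hn⟩ : ∃ n, Nat.find hex = n + 1 := Nat.exists_eq_succ_of_ne_zero fun h0 => by
    have := Nat.find_spec hex
    rw [h0, coords_zero] at this
    simp at this
  have hn1 : q ∈ coords a (n + 1) := hn ▸ Nat.find_spec hex
  have hn2 : q ∉ coords a n := Nat.find_min hex (by omega)
  refine ⟨n, hn2, ?_⟩
  convert (hT n).compl using 1
  ext ω
  simp only [Set.mem_ofPred_eq, Set.mem_compl_iff, not_le]
  exact ⟨fun h => not_le.1 fun hle => hn2 (coords_mono hle h),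
    fun h => coords_mono (Nat.succ_le_of_lt h) hn1⟩

lemma integrable_term (hT : ∀ n, DeterminedBy (coords a n) {ω : S × ℕ → X | T ω ≤ n})
    {q : S × ℕ} (hq : q ∈ coords a m) (h : X → ℝ) :
    Integrable ({ω : S × ℕ → X | q ∈ coords a (T ω)}.indicator fun ω => h (ω q)) (seqLaw D') := by
  obtain ⟨n, -, hn⟩ := exists_determinedBy hT hq
  refine Integrable.indicator ?_ hn.measurableSet
  refine Integrable.of_bound (C := ∑ x, |h x|)
    (((measurable_of_countable h).comp (measurable_pi_apply q)).aestronglyMeasurable)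
    (Eventually.of_forall fun ω => ?_)
  exact Finset.single_le_sum (f := fun x => |h x|) (fun _ _ => abs_nonneg _)
    (Finset.mem_univ (ω q))

lemma integrable_stoppedLogRatio
    (hT : ∀ n, DeterminedBy (coords a n) {ω : S × ℕ → X | T ω ≤ n}) :
    Integrable (stoppedLogRatio D' D a m T) (seqLaw D') :=
  integrable_finsetSum _ fun _ hq => integrable_term hT hq _

/-- Wald's identity: the relative entropy of the observations at a bounded stopping time. -/
lemma integral_stoppedLogRatio (hT : ∀ n, DeterminedBy (coords a n) {ω : S × ℕ → X | T ω ≤ n})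
    (hTm : ∀ ω, T ω ≤ m) :
    ∫ ω, stoppedLogRatio D' D a m T ω ∂(seqLaw D') =
      ∫ ω, ∑ s, len (a s) (T ω) * symbolDiv D' D s ∂(seqLaw D') := by
  classical
  have h1 : ∀ ω, ∑ s, len (a s) (T ω) * symbolDiv D' D s =
      ∑ q ∈ coords a m, {ω : S × ℕ → X | q ∈ coords a (T ω)}.indicator
        (fun _ => symbolDiv D' D q.1) ω := fun ω => by
    rw [← sum_coords]
    simp only [Set.indicator_apply, Set.mem_ofPred_eq]
    rw [← Finset.sum_filter]
    refine Finset.sum_congr ?_ fun _ _ => rfl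
    ext q
    simp only [Finset.mem_filter]
    exact ⟨fun h => ⟨coords_mono (hTm ω) h, h⟩, fun h => h.2⟩
  simp_rw [h1]
  unfold stoppedLogRatio
  rw [integral_finsetSum _ fun q hq => integrable_term hT hq _,
    integral_finsetSum _ fun q hq => integrable_term hT hq fun _ => symbolDiv D' D q.1]
  refine Finset.sum_congr rfl fun q hq => ?_
  obtain ⟨n, hn, hdet⟩ := exists_determinedBy hT hq
  rw [integral_indicator_symbol D' hn hdet, integral_indicator_symbol D' hn hdet
    fun _ => symbolDiv D' D q.1, ← Finset.sum_mul, PMF_sum_toReal, one_mul]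
  rfl

end

/-- A log-sum inequality: if `exp (-L)` is a density up to normalization, then an event of
probability `q` has probability at least `q exp (-(E[L] + 1) / q)` under the new measure. -/
lemma mul_exp_le_setIntegral_exp_neg {Ω : Type*} [MeasurableSpace Ω] {μ : Measure Ω}
    [IsProbabilityMeasure μ] {L : Ω → ℝ} (hL : Integrable L μ)
    (hexp : Integrable (fun ω => Real.exp (-L ω)) μ) (hone : ∫ ω, Real.exp (-L ω) ∂μ ≤ 1)
    {A : Set Ω} (hA : MeasurableSet A) (hq : 0 < μ.real A) :
    μ.real A * Real.exp (-((∫ ω, L ω ∂μ + 1) / μ.real A)) ≤ ∫ ω in A, Real.exp (-L ω) ∂μ := by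
  set q := μ.real A
  set G := ∫ ω, L ω ∂μ
  set c := (G + 1) / q
  have h1 : ∫ ω in A, L ω ∂μ ≤ G + 1 := by
    have h2 : -∫ ω in Aᶜ, L ω ∂μ ≤ ∫ ω in Aᶜ, Real.exp (-L ω) ∂μ := by
      rw [← integral_neg]
      refine integral_mono hL.integrableOn.neg hexp.integrableOn fun ω => ?_
      have := Real.add_one_le_exp (-L ω)
      simp only
      linarith
    have h3 : ∫ ω in Aᶜ, Real.exp (-L ω) ∂μ ≤ ∫ ω, Real.exp (-L ω) ∂μ :=
      setIntegral_le_integral hexp (Eventually.of_forall fun _ => (Real.exp_pos _).le)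
    have h4 := integral_add_compl hA hL
    linarith
  -- Convexity of `exp` at the point `-c` plays the role of Jensen's inequality on `A`.
  have h5 : ∫ ω in A, Real.exp (-c) * (1 + c - L ω) ∂μ ≤ ∫ ω in A, Real.exp (-L ω) ∂μ := by
    refine integral_mono (((integrable_const _).sub hL.integrableOn).const_mul _)
      hexp.integrableOn fun ω => ?_
    have h6 := Real.add_one_le_exp (c - L ω)
    have h7 : Real.exp (-L ω) = Real.exp (-c) * Real.exp (c - L ω) := by
      rw [← Real.exp_add]; congr 1; ring
    simp only
    rw [h7]
    exact mul_le_mul_of_nonneg_left (by linarith) (Real.exp_pos _).le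
  refine le_trans ?_ h5
  rw [integral_const_mul, integral_sub (integrable_const _) hL.integrableOn, setIntegral_const,
    mul_comm, smul_eq_mul]
  refine mul_le_mul_of_nonneg_left ?_ (Real.exp_pos _).le
  have h8 : q * c = G + 1 := mul_div_cancel₀ _ hq.ne'
  change q ≤ q * (1 + c) - _
  linarith

section

variable {S X : Type*} [Fintype S] {a : S → ℝ} [Fintype X] [MeasurableSpace X]
  [MeasurableSingletonClass X]

/-- Data processing for stopped observations: an event of probability `q` under `D'` that is
decided at a bounded stopping time has, under `D`, a probability that is at least exponential in
the expected number of observed symbols. -/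
lemma mul_exp_le_seqLaw (ha : ∀ s, 0 ≤ a s) {D' D : S → PMF X} (hD' : ∀ s x, D' s x ≠ 0)
    (hD : ∀ s x, D s x ≠ 0) {m : ℕ} {T : (S × ℕ → X) → ℕ} (hTm : ∀ ω, T ω ≤ m)
    (hT : ∀ n, DeterminedBy (coords a n) {ω : S × ℕ → X | T ω ≤ n}) {N : ℝ}
    (hN : ∫ ω, (T ω : ℝ) ∂(seqLaw D') ≤ N) {A : Set (S × ℕ → X)}
    (hA : ∀ n ≤ m, DeterminedBy (coords a n) (A ∩ {ω | T ω = n}))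
    (hq : 0 < (seqLaw D').real A) :
    (seqLaw D').real A * Real.exp (-((∑ s, symbolDiv D' D s * (a s * N + 1) + 1) /
      (seqLaw D').real A)) ≤ (seqLaw D).real A := by
  have hTeq : ∀ n, DeterminedBy (coords a n) {ω : S × ℕ → X | T ω = n} := fun n => by
    rcases n with _ | n
    · convert hT 0 using 1
      ext ω
      simp
    · convert (hT (n + 1)).inter ((hT n).mono (coords_mono n.le_succ)).compl using 1
      ext ω
      simp only [Set.mem_ofPred_eq, Set.mem_inter_iff, Set.mem_compl_iff]
      omega
  have hTmeas : Measurable T := measurable_to_countable' fun n => (hTeq n).measurableSet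
  have hTint : Integrable (fun ω => (T ω : ℝ)) (seqLaw D') :=
    Integrable.of_bound (C := m) (by fun_prop) (Eventually.of_forall fun ω => by
      simpa using hTm ω)
  have hLint : Integrable (stoppedLogRatio D' D a m T) (seqLaw D') :=
    integrable_stoppedLogRatio hT
  have hAmeas : MeasurableSet A := by
    have : A = ⋃ n ∈ Set.Iic m, A ∩ {ω | T ω = n} := by
      ext ω
      simpa using fun _ => hTm ω
    rw [this]
    exact MeasurableSet.biUnion (Set.to_countable _) fun n hn => (hA n hn).measurableSet
  have hcm := setLIntegral_exp_neg_stoppedLogRatio (a := a) hD' hD hTm hA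
  have hcm1 := setLIntegral_exp_neg_stoppedLogRatio (a := a) (E := Set.univ) hD' hD hTm
    fun n _ => by rw [Set.univ_inter]; exact hTeq n
  rw [setLIntegral_univ, measure_univ] at hcm1
  have hexpmeas : AEStronglyMeasurable
      (fun ω => Real.exp (-stoppedLogRatio D' D a m T ω)) (seqLaw D') :=
    Real.continuous_exp.comp_aestronglyMeasurable hLint.aestronglyMeasurable.neg
  have hexp : Integrable (fun ω => Real.exp (-stoppedLogRatio D' D a m T ω)) (seqLaw D') := by
    refine ⟨hexpmeas, (hasFiniteIntegral_iff_ofReal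
      (Eventually.of_forall fun _ => (Real.exp_pos _).le)).2 ?_⟩
    rw [hcm1]
    exact ENNReal.one_lt_top
  have hone : ∫ ω, Real.exp (-stoppedLogRatio D' D a m T ω) ∂(seqLaw D') ≤ 1 := by
    rw [integral_eq_lintegral_of_nonneg_ae (Eventually.of_forall fun _ => (Real.exp_pos _).le)
      hexpmeas, hcm1]
    simp
  have hAexp : ∫ ω in A, Real.exp (-stoppedLogRatio D' D a m T ω) ∂(seqLaw D') =
      (seqLaw D).real A := by
    rw [integral_eq_lintegral_of_nonneg_ae (Eventually.of_forall fun _ => (Real.exp_pos _).le)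
      hexpmeas.restrict, hcm]
    rfl
  have hmain := mul_exp_le_setIntegral_exp_neg hLint hexp hone hAmeas hq
  rw [hAexp] at hmain
  refine le_trans (mul_le_mul_of_nonneg_left (Real.exp_le_exp.2 (neg_le_neg ?_)) hq.le) hmain
  refine div_le_div_of_nonneg_right ?_ hq.le
  rw [integral_stoppedLogRatio hT hTm]
  refine add_le_add ?_ le_rfl
  have hsum : ∫ ω, ∑ s, symbolDiv D' D s * (a s * (T ω : ℝ) + 1) ∂(seqLaw D') =
      ∑ s, symbolDiv D' D s * (a s * ∫ ω, (T ω : ℝ) ∂(seqLaw D') + 1) := by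
    have hint : ∀ s, Integrable (fun ω => a s * (T ω : ℝ) + 1) (seqLaw D') := fun s =>
      (hTint.const_mul _).add (integrable_const _)
    rw [integral_finsetSum _ fun s _ => (hint s).const_mul _]
    refine Finset.sum_congr rfl fun s _ => ?_
    rw [integral_const_mul, integral_add (hTint.const_mul _) (integrable_const _),
      integral_const_mul, integral_const]
    simp
  have hle : ∫ ω, ∑ s, len (a s) (T ω) * symbolDiv D' D s ∂(seqLaw D') ≤
      ∫ ω, ∑ s, symbolDiv D' D s * (a s * (T ω : ℝ) + 1) ∂(seqLaw D') := by
    refine integral_mono_of_nonneg (Eventually.of_forall fun ω => Finset.sum_nonneg fun s _ =>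
      mul_nonneg (Nat.cast_nonneg _) (symbolDiv_nonneg hD s))
      (integrable_finsetSum _ fun s _ => ((hTint.const_mul _).add (integrable_const _)).const_mul _)
      (Eventually.of_forall fun ω => Finset.sum_le_sum fun s _ => ?_)
    rw [mul_comm]
    exact mul_le_mul_of_nonneg_left (len_le (ha s) _) (symbolDiv_nonneg hD s)
  refine hle.trans (hsum.trans_le (Finset.sum_le_sum fun s _ =>
    mul_le_mul_of_nonneg_left ?_ (symbolDiv_nonneg hD s)))
  have := mul_le_mul_of_nonneg_left hN (ha s)
  linarith

end

/-! ### The converse for a fixed alternative -/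

section

variable {X : Type*} [MeasurableSpace X] {M₁ M₂ K : ℕ} {α β : ℝ}

/-- The rates at which the sequences of the two databases are observed. -/
def obsRate (M₁ M₂ : ℕ) (α β : ℝ) : Fin M₁ ⊕ Fin M₂ → ℝ := Sum.elim (fun _ => α) fun _ => β

lemma determinedBy_of_measurableSet {n : ℕ} {E : Set (Path X M₁ M₂)}
    (hE : MeasurableSet[obsFiltration X M₁ M₂ α β n] E) :
    DeterminedBy (coords (obsRate M₁ M₂ α β) n) E := by
  obtain ⟨D, -, rfl⟩ := hE
  refine ⟨{z | ((fun i k => z ⟨(Sum.inl i, k), mem_coords.2 k.2⟩,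
    fun j k => z ⟨(Sum.inr j, k), mem_coords.2 k.2⟩) : Data X M₁ M₂ α β n) ∈ D}, rfl⟩

/-- The stopping time, truncated at the horizon `m`. -/
noncomputable def SeqTest.truncTime (Φ : SeqTest X M₁ M₂ K α β) (m : ℕ) (ω : Path X M₁ M₂) : ℕ :=
  (min (Φ.τ ω) m).toNat

/-- The event that the test decides for `t` by time `m`. -/
def SeqTest.decideBy (Φ : SeqTest X M₁ M₂ K α β) (t : Matching M₁ M₂ K) (m : ℕ) :
    Set (Path X M₁ M₂) :=
  {ω | ∃ n ≤ m, Φ.τ ω = n ∧ Φ.φ n (obs α β n ω) = t}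

lemma SeqTest.coe_truncTime (Φ : SeqTest X M₁ M₂ K α β) (m : ℕ) (ω : Path X M₁ M₂) :
    (Φ.truncTime m ω : ℕ∞) = min (Φ.τ ω) m :=
  ENat.natCast_toNat ((min_le_right _ _).trans_lt (ENat.natCast_lt_top m)).ne

lemma SeqTest.truncTime_le (Φ : SeqTest X M₁ M₂ K α β) (m : ℕ) (ω : Path X M₁ M₂) :
    Φ.truncTime m ω ≤ m := by
  rw [← Nat.cast_le (α := ℕ∞), Φ.coe_truncTime]
  exact min_le_right _ _

lemma SeqTest.determinedBy_truncTime_le (Φ : SeqTest X M₁ M₂ K α β) (m n : ℕ) :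
    DeterminedBy (coords (obsRate M₁ M₂ α β) n) {ω | Φ.truncTime m ω ≤ n} := by
  have h : {ω | Φ.truncTime m ω ≤ n} = {ω | Φ.τ ω ≤ n ∨ m ≤ n} := by
    ext ω
    simp only [Set.mem_ofPred_eq]
    rw [← Nat.cast_le (α := ℕ∞), Φ.coe_truncTime, min_le_iff, Nat.cast_le]
  rw [h]
  by_cases hmn : m ≤ n
  · simp only [hmn, or_true]
    exact ⟨Set.univ, rfl⟩
  · simp only [hmn, or_false]
    exact determinedBy_of_measurableSet (Φ.isStoppingTime n)

variable [Fintype X] [MeasurableSingletonClass X]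

lemma SeqTest.determinedBy_eq_and_decision (Φ : SeqTest X M₁ M₂ K α β) (t : Matching M₁ M₂ K)
    (n : ℕ) : DeterminedBy (coords (obsRate M₁ M₂ α β) n)
      {ω | Φ.τ ω = n ∧ Φ.φ n (obs α β n ω) = t} := by
  refine (determinedBy_of_measurableSet (Φ.isStoppingTime.measurableSet_eq n)).inter
    (determinedBy_of_measurableSet (E := {ω | Φ.φ n (obs α β n ω) = t}) ?_)
  exact ⟨{d | Φ.φ n d = t}, Set.Finite.measurableSet (Set.toFinite _), rfl⟩

lemma SeqTest.determinedBy_decideBy (Φ : SeqTest X M₁ M₂ K α β) (t : Matching M₁ M₂ K)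
    {m n : ℕ} (hn : n ≤ m) : DeterminedBy (coords (obsRate M₁ M₂ α β) n)
      (Φ.decideBy t m ∩ {ω | Φ.truncTime m ω = n}) := by
  convert Φ.determinedBy_eq_and_decision t n using 1
  ext ω
  simp only [SeqTest.decideBy, Set.mem_inter_iff, Set.mem_ofPred_eq]
  constructor
  · rintro ⟨⟨k, hk, hτ, hφ⟩, hT⟩
    have : k = n := by
      rw [← Nat.cast_inj (R := ℕ∞), ← hT, Φ.coe_truncTime, hτ, min_eq_left (Nat.cast_le.2 hk)]
    subst this
    exact ⟨hτ, hφ⟩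
  · rintro ⟨hτ, hφ⟩
    refine ⟨⟨n, hn, hτ, hφ⟩, ?_⟩
    rw [← Nat.cast_inj (R := ℕ∞), Φ.coe_truncTime, hτ, min_eq_left (Nat.cast_le.2 hn)]

lemma SeqTest.integral_truncTime_le (Φ : SeqTest X M₁ M₂ K α β) (m : ℕ) {P : Fin M₁ → PMF X}
    {Q : Fin M₂ → PMF X} {N : ℕ} (h : Φ.expectedTime P Q ≤ N) :
    ∫ ω, (Φ.truncTime m ω : ℝ) ∂(law P Q) ≤ N := by
  have hmeas : Measurable (Φ.truncTime m) := by
    refine measurable_to_countable' fun n => ?_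
    rcases n with _ | n
    · convert (Φ.determinedBy_truncTime_le m 0).measurableSet using 1
      ext ω
      simp
    · convert (Φ.determinedBy_truncTime_le m (n + 1)).measurableSet.diff
        (Φ.determinedBy_truncTime_le m n).measurableSet using 1
      ext ω
      simp only [Set.mem_preimage, Set.mem_singleton_iff, Set.mem_sdiff, Set.mem_ofPred_eq]
      omega
  rw [integral_eq_lintegral_of_nonneg_ae (Eventually.of_forall fun _ => Nat.cast_nonneg _)
    (by fun_prop)]
  refine ENNReal.toReal_le_of_le_ofReal (Nat.cast_nonneg _) ?_
  rw [ENNReal.ofReal_natCast]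
  refine (lintegral_mono fun ω => ?_).trans h
  rw [ENNReal.ofReal_natCast, ← ENat.toENNReal_coe, Φ.coe_truncTime]
  exact ENat.toENNReal_mono (min_le_left _ _)

/-- If `t` is decided with probability more than `ρ` under an alternative `(P', Q')`, then the
mismatch probability under `(P, Q)` is bounded below by the relative entropy of the observations
in the expected time `N`. -/
lemma SeqTest.le_mismatchProb (hα : 0 < α) (hβ : 0 < β) (Φ : SeqTest X M₁ M₂ K α β)
    {t l : Matching M₁ M₂ K} (htl : t ≠ l) {P P' : Fin M₁ → PMF X} {Q Q' : Fin M₂ → PMF X}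
    (hPQ : FullSupport P Q) (hPQ' : FullSupport P' Q') {N : ℕ} (hN : Φ.expectedTime P' Q' ≤ N)
    {ρ : ℝ} (hρ : 0 < ρ) (hmis : Φ.mismatchProb t P' Q' < ENNReal.ofReal (1 - ρ)) :
    ENNReal.ofReal (ρ * Real.exp (-((∑ s, symbolDiv (Sum.elim P' Q') (Sum.elim P Q) s *
      (obsRate M₁ M₂ α β s * N + 1) + 1) / ρ))) ≤ Φ.mismatchProb l P Q := by
  have ha : ∀ s, 0 ≤ obsRate M₁ M₂ α β s := fun s => by
    rcases s with i | j
    · exact hα.le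
    · exact hβ.le
  have hfull : ∀ {P : Fin M₁ → PMF X} {Q : Fin M₂ → PMF X}, FullSupport P Q →
      ∀ s x, Sum.elim P Q s x ≠ 0 := fun h s => by
    rcases s with i | j
    · exact h.1 i
    · exact h.2 j
  have hAmeas : ∀ m, MeasurableSet (Φ.decideBy t m) := fun m => by
    have : Φ.decideBy t m = ⋃ n ∈ Set.Iic m, {ω | Φ.τ ω = n ∧ Φ.φ n (obs α β n ω) = t} := by
      ext ω
      simp only [SeqTest.decideBy, Set.mem_iUnion, Set.mem_ofPred_eq, Set.mem_Iic, exists_prop]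
    rw [this]
    exact MeasurableSet.biUnion (Set.to_countable _) fun n _ =>
      (Φ.determinedBy_eq_and_decision t n).measurableSet
  have hmono : Monotone (Φ.decideBy t) := fun m m' hm ω ⟨n, hn, h⟩ => ⟨n, hn.trans hm, h⟩
  -- The decision for `t` is made by some finite time with probability more than `ρ`.
  obtain ⟨m, hm⟩ : ∃ m, ENNReal.ofReal ρ < law P' Q' (Φ.decideBy t m) := by
    have hU : {ω | ¬ ∃ n : ℕ, Φ.τ ω = n ∧ Φ.φ n (obs α β n ω) = t} =
        (⋃ m, Φ.decideBy t m)ᶜ := by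
      ext ω
      simp only [Set.mem_ofPred_eq, Set.mem_compl_iff, Set.mem_iUnion, SeqTest.decideBy]
      exact not_congr ⟨fun ⟨n, h⟩ => ⟨n, n, le_rfl, h⟩, fun ⟨_, n, _, h⟩ => ⟨n, h⟩⟩
    unfold SeqTest.mismatchProb at hmis
    rw [hU, prob_compl_eq_one_sub (MeasurableSet.iUnion hAmeas)] at hmis
    have h1 : ENNReal.ofReal ρ < law P' Q' (⋃ m, Φ.decideBy t m) := by
      by_contra! hle
      refine absurd hmis (not_lt.2 ?_)
      rw [ENNReal.ofReal_sub _ hρ.le, ENNReal.ofReal_one]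
      exact tsub_le_tsub_left hle 1
    exact ((tendsto_measure_iUnion_atTop hmono).eventually_const_lt h1).exists
  set q := (law P' Q').real (Φ.decideBy t m) with hq
  have hρq : ρ < q := (ENNReal.ofReal_lt_iff_lt_toReal hρ.le (measure_ne_top _ _)).1 hm
  have h1 := mul_exp_le_seqLaw (D' := Sum.elim P' Q') (D := Sum.elim P Q) ha (hfull hPQ')
    (hfull hPQ) (Φ.truncTime_le m) (Φ.determinedBy_truncTime_le m)
    (Φ.integral_truncTime_le m hN) (A := Φ.decideBy t m)
    (fun n hn => Φ.determinedBy_decideBy t hn) (hρ.trans hρq)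
  have h2 : law P Q (Φ.decideBy t m) ≤ Φ.mismatchProb l P Q := by
    refine measure_mono fun ω ⟨n, _, hτ, hφ⟩ ⟨k, hτ', hφ'⟩ => htl ?_
    have : n = k := by
      rw [hτ] at hτ'
      exact Nat.cast_inj.1 hτ'
    subst this
    rw [← hφ, ← hφ']
  refine le_trans ?_ h2
  refine ENNReal.ofReal_le_of_le_toReal (le_trans ?_ h1)
  have h3 : 0 ≤ ∑ s, symbolDiv (Sum.elim P' Q') (Sum.elim P Q) s *
      (obsRate M₁ M₂ α β s * N + 1) + 1 := by
    have : ∀ s, 0 ≤ symbolDiv (Sum.elim P' Q') (Sum.elim P Q) s *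
        (obsRate M₁ M₂ α β s * N + 1) := fun s => by
      have := ha s
      have := symbolDiv_nonneg (D' := Sum.elim P' Q') (hfull hPQ) s
      positivity
    have := Finset.sum_nonneg fun s (_ : s ∈ Finset.univ) => this s
    linarith
  exact mul_le_mul hρq.le (Real.exp_le_exp.2 (neg_le_neg
    (div_le_div_of_nonneg_left h3 hρ hρq.le))) (Real.exp_pos _).le (hρ.trans hρq).le

/-- The rate of a consistent universal test is at most the relative entropy rate with respect to
any alternative. -/
lemma eventually_mismatchRate_le (hα : 0 < α) (hβ : 0 < β) {Φ : ℕ → SeqTest X M₁ M₂ K α β}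
    (huniv : ∀ᶠ N in atTop, (Φ N).IsUniversal N) {t l : Matching M₁ M₂ K} (htl : t ≠ l)
    {P P' : Fin M₁ → PMF X} {Q Q' : Fin M₂ → PMF X} (hPQ : FullSupport P Q)
    (hPQ' : FullSupport P' Q') (ht : IsGenerating t P' Q')
    (hcons : Tendsto (fun N => (Φ N).mismatchProb t P' Q') atTop (𝓝 0)) {c : ℝ}
    (hc : ∑ s, obsRate M₁ M₂ α β s * symbolDiv (Sum.elim P' Q') (Sum.elim P Q) s < c) :
    ∀ᶠ N in atTop, (Φ N).mismatchRate N l P Q ≤ (c : EReal) := by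
  set W := ∑ s, obsRate M₁ M₂ α β s * symbolDiv (Sum.elim P' Q') (Sum.elim P Q) s
  set Z := ∑ s, symbolDiv (Sum.elim P' Q') (Sum.elim P Q) s
  obtain ⟨ρ, hWρ, hρ0, hρ1⟩ : ∃ ρ : ℝ, W / ρ < c ∧ 0 < ρ ∧ ρ < 1 := by
    have h1 : ContinuousAt (fun ρ : ℝ => W / ρ) 1 := 
      continuousAt_const.div continuousAt_id one_ne_zero
    have h2 := h1.eventually_lt (continuousAt_const (y := c)) (by simpa using hc)
    obtain ⟨ρ, h3, h4⟩ := ((h2.filter_mono nhdsWithin_le_nhds).and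
      (Ioo_mem_nhdsLT (zero_lt_one (α := ℝ)))).exists
    exact ⟨ρ, h3, h4⟩
  have hlim : Tendsto (fun N : ℕ => W / ρ + ((Z + 1) / ρ - Real.log ρ) / N) atTop
      (𝓝 (W / ρ + 0)) :=
    tendsto_const_nhds.add (tendsto_const_div_atTop_nhds_zero_nat _)
  rw [add_zero] at hlim
  filter_upwards [huniv, hcons.eventually_lt_const
    (show (0 : ℝ≥0∞) < ENNReal.ofReal (1 - ρ) by rw [ENNReal.ofReal_pos]; linarith),
    hlim.eventually_lt_const hWρ, eventually_gt_atTop 0] with N hN hmis hlt hN0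
  refine SeqTest.mismatchRate_le hN0 (le_trans (ENNReal.ofReal_le_ofReal ?_)
    ((Φ N).le_mismatchProb hα hβ htl hPQ hPQ' (hN t P' Q' ht) hρ0 hmis))
  rw [show ∑ s, symbolDiv (Sum.elim P' Q') (Sum.elim P Q) s * (obsRate M₁ M₂ α β s * N + 1) =
    W * N + Z by
      simp only [W, Z]
      rw [Finset.sum_mul, ← Finset.sum_add_distrib]
      exact Finset.sum_congr rfl fun s _ => by ring]
  have h1 : ρ = Real.exp (Real.log ρ) := (Real.exp_log hρ0).symm
  nth_rewrite 1 [h1]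
  rw [← Real.exp_add, Real.exp_le_exp]
  have hN' : (0 : ℝ) < N := by positivity
  have h2 := mul_lt_mul_of_pos_left hlt hN'
  rw [mul_add, mul_div_cancel₀ _ hN'.ne'] at h2
  have h3 : (W * N + Z + 1) / ρ = N * (W / ρ) + (Z + 1) / ρ := by
    field_simp
    ring
  rw [h3]
  linarith

end

/-! ### Construction of the alternatives -/

section

variable {X : Type*} [Fintype X]

/-- The distribution with a given positive probability mass function. -/
noncomputable def pmfOfReal (v : X → ℝ) (hv : ∀ x, 0 < v x) (hv1 : ∑ x, v x = 1) : PMF X :=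
  PMF.ofFintype (fun x => ENNReal.ofReal (v x)) (by
    rw [← ENNReal.ofReal_sum_of_nonneg fun x _ => (hv x).le, hv1, ENNReal.ofReal_one])

lemma toReal_pmfOfReal {v : X → ℝ} (hv : ∀ x, 0 < v x) (hv1 : ∑ x, v x = 1) (x : X) :
    (pmfOfReal v hv hv1 x).toReal = v x := by
  rw [pmfOfReal, PMF.ofFintype_apply, ENNReal.toReal_ofReal (hv x).le]

/-- Positive distributions that agree within the classes of a labelling can be perturbed so that
distributions with different labels become different, at arbitrarily small cost. The distribution
with label `k` is moved by `ε k` along a fixed direction: for small `ε` this separates also the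
distributions that coincided before. -/
lemma exists_perturbation [Nontrivial X] {S : Type*} [Fintype S] (V : S → X → ℝ)
    (hV : ∀ s x, 0 < V s x) (hV1 : ∀ s, ∑ x, V s x = 1) (k : S → ℕ)
    (hk : ∀ s s', k s = k s' → V s = V s') (a : S → ℝ) (p : S → X → ℝ)
    (hp : ∀ s x, 0 < p s x) {c : ℝ} (hc : ∑ s, a s * klSum (V s) (p s) < c) :
    ∃ D : S → PMF X, (∀ s x, D s x ≠ 0) ∧ (∀ s s', D s = D s' ↔ k s = k s') ∧
      ∑ s, a s * klSum (fun x => (D s x).toReal) (p s) < c := by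
  classical
  obtain ⟨x₀, x₁, hx⟩ := exists_pair_ne X
  let w : X → ℝ := Pi.single x₀ 1 - Pi.single x₁ 1
  have hw : ∑ x, w x = 0 := by simp [w]
  have hw0 : w x₀ = 1 := by simp [w, hx]
  let W : ℝ → S → X → ℝ := fun ε s x => V s x + ε * k s * w x
  have hW0 : ∀ s, W 0 s = V s := fun s => by funext x; simp [W]
  have hcont : ∀ s x, ContinuousAt (fun ε => W ε s x) 0 := fun s x => by
    simp only [W]; fun_prop
  have hpos : ∀ᶠ ε in 𝓝[>] (0 : ℝ), ∀ s x, 0 < W ε s x := by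
    refine eventually_all.2 fun s => eventually_all.2 fun x => ?_
    refine ((hcont s x).eventually_const_lt ?_).filter_mono nhdsWithin_le_nhds
    change 0 < W 0 s x
    rw [hW0]
    exact hV s x
  have hsep : ∀ᶠ ε in 𝓝[>] (0 : ℝ), ∀ s s', k s ≠ k s' → W ε s ≠ W ε s' := by
    refine eventually_all.2 fun s => eventually_all.2 fun s' => ?_
    by_cases hV' : V s x₀ = V s' x₀
    · filter_upwards [self_mem_nhdsWithin] with ε hε hks hW
      have h1 := congrFun hW x₀
      simp only [W, hw0, hV', mul_one, add_right_inj] at h1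
      exact hks (Nat.cast_injective (mul_left_cancel₀ (ne_of_gt hε) h1))
    · have h1 : ∀ᶠ ε in 𝓝 (0 : ℝ), W ε s x₀ - W ε s' x₀ ≠ 0 := by
        refine ((hcont s x₀).sub (hcont s' x₀)).eventually_ne ?_
        change W 0 s x₀ - W 0 s' x₀ ≠ 0
        rw [hW0, hW0]
        exact sub_ne_zero.2 hV'
      filter_upwards [h1.filter_mono nhdsWithin_le_nhds] with ε hε _ hW
      exact hε (by rw [hW, sub_self])
  have hcost : ∀ᶠ ε in 𝓝[>] (0 : ℝ), ∑ s, a s * klSum (W ε s) (p s) < c := by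
    have h1 : ContinuousAt (fun ε => ∑ s, a s * klSum (W ε s) (p s)) 0 := by
      unfold klSum
      refine tendsto_finsetSum _ fun s _ => Tendsto.const_mul _ (tendsto_finsetSum _ fun x _ => ?_)
      refine (hcont s x).mul (((hcont s x).div_const _).log ?_)
      rw [hW0]
      exact (div_pos (hV s x) (hp s x)).ne'
    refine (h1.eventually_lt_const ?_).filter_mono nhdsWithin_le_nhds
    simpa only [hW0] using hc
  obtain ⟨ε, h1, h2, h3⟩ := (hpos.and (hsep.and hcost)).exists
  have hW1 : ∀ s, ∑ x, W ε s x = 1 := fun s => by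
    simp only [W]
    rw [Finset.sum_add_distrib, hV1, ← Finset.mul_sum, hw, mul_zero, add_zero]
  refine ⟨fun s => pmfOfReal (W ε s) (h1 s) (hW1 s), fun s x h0 => ?_, fun s s' => ?_, ?_⟩
  · have := toReal_pmfOfReal (h1 s) (hW1 s) x
    rw [h0, ENNReal.toReal_zero] at this
    exact (h1 s x).ne this
  · constructor
    · intro h
      by_contra hne
      refine h2 s s' hne (funext fun x => ?_)
      simpa only [toReal_pmfOfReal] using congrArg (fun r : PMF X => (r x).toReal) h
    · intro h
      have : W ε s = W ε s' := by
        simp only [W, h, hk s s' h]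
      change pmfOfReal (W ε s) _ _ = pmfOfReal (W ε s') _ _
      congr 1
  · simpa only [toReal_pmfOfReal] using h3

end

section

variable {M₁ M₂ K : ℕ} (t : Matching M₁ M₂ K)

lemma Matching.fst_unique {i i' : Fin M₁} {j : Fin M₂} (h : (i, j) ∈ t.1) (h' : (i', j) ∈ t.1) :
    i = i' := congrArg Prod.fst (t.2.2.2 h h' rfl)

lemma Matching.snd_unique {i : Fin M₁} {j j' : Fin M₂} (h : (i, j) ∈ t.1) (h' : (i, j') ∈ t.1) :
    j = j' := congrArg Prod.snd (t.2.2.1 h h' rfl)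

open Classical in
/-- A label for each sequence, such that exactly the sequences matched by `t` share a label. -/
noncomputable def Matching.label : Fin M₁ ⊕ Fin M₂ → ℕ :=
  Sum.elim (fun i => i) fun j => if h : ∃ i, (i, j) ∈ t.1 then (h.choose : ℕ) else M₁ + j

lemma Matching.label_inr_of_mem {i : Fin M₁} {j : Fin M₂} (h : (i, j) ∈ t.1) :
    t.label (Sum.inr j) = i := by
  have hex : ∃ i, (i, j) ∈ t.1 := ⟨i, h⟩
  simp only [Matching.label, Sum.elim_inr, dif_pos hex]
  rw [t.fst_unique hex.choose_spec h]

lemma Matching.label_inr_of_forall {j : Fin M₂} (h : ¬ ∃ i, (i, j) ∈ t.1) :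
    t.label (Sum.inr j) = M₁ + j := by
  simp only [Matching.label, Sum.elim_inr, dif_neg h]

lemma Matching.label_inl (i : Fin M₁) : t.label (Sum.inl i) = i := rfl

lemma Matching.label_inl_eq_inr_iff {i : Fin M₁} {j : Fin M₂} :
    t.label (Sum.inl i) = t.label (Sum.inr j) ↔ (i, j) ∈ t.1 := by
  rw [t.label_inl]
  by_cases h : ∃ i, (i, j) ∈ t.1
  · obtain ⟨i', hi'⟩ := h
    rw [t.label_inr_of_mem hi', Fin.val_inj]
    exact ⟨fun h => h ▸ hi', fun h => t.fst_unique h hi'⟩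
  · rw [t.label_inr_of_forall h]
    have := i.2
    exact ⟨fun h' => by omega, fun h' => absurd ⟨i, h'⟩ h⟩

lemma Matching.label_inr_injective {j j' : Fin M₂}
    (h : t.label (Sum.inr j) = t.label (Sum.inr j')) : j = j' := by
  by_cases h1 : ∃ i, (i, j) ∈ t.1
  · obtain ⟨i, hi⟩ := h1
    rw [t.label_inr_of_mem hi, ← t.label_inl, t.label_inl_eq_inr_iff] at h
    exact t.snd_unique hi h
  · by_cases h2 : ∃ i, (i, j') ∈ t.1
    · obtain ⟨i, hi⟩ := h2
      rw [t.label_inr_of_mem hi, ← t.label_inl, eq_comm, t.label_inl_eq_inr_iff] at h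
      exact absurd ⟨i, h⟩ h1
    · rw [t.label_inr_of_forall h1, t.label_inr_of_forall h2] at h
      exact Fin.ext (by omega)

variable {X : Type*} [Fintype X]

open Classical in
/-- The least costly distributions under which `t` is true: the two sequences of a pair in `t`
get the tilted distribution of their original distributions `p`. -/
noncomputable def Matching.alternative (α β : ℝ) (p : Fin M₁ ⊕ Fin M₂ → X → ℝ) :
    Fin M₁ ⊕ Fin M₂ → X → ℝ :=
  Sum.elim
    (fun i => if h : ∃ j, (i, j) ∈ t.1 then
      tilted α β (p (Sum.inl i)) (p (Sum.inr h.choose)) else p (Sum.inl i))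
    (fun j => if h : ∃ i, (i, j) ∈ t.1 then
      tilted α β (p (Sum.inl h.choose)) (p (Sum.inr j)) else p (Sum.inr j))

variable {α β : ℝ} {p : Fin M₁ ⊕ Fin M₂ → X → ℝ}

lemma Matching.alternative_inl {i : Fin M₁} {j : Fin M₂} (h : (i, j) ∈ t.1) :
    t.alternative α β p (Sum.inl i) = tilted α β (p (Sum.inl i)) (p (Sum.inr j)) := by
  have hex : ∃ j, (i, j) ∈ t.1 := ⟨j, h⟩
  simp only [Matching.alternative, Sum.elim_inl, dif_pos hex]
  rw [t.snd_unique hex.choose_spec h]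

lemma Matching.alternative_inr {i : Fin M₁} {j : Fin M₂} (h : (i, j) ∈ t.1) :
    t.alternative α β p (Sum.inr j) = tilted α β (p (Sum.inl i)) (p (Sum.inr j)) := by
  have hex : ∃ i, (i, j) ∈ t.1 := ⟨i, h⟩
  simp only [Matching.alternative, Sum.elim_inr, dif_pos hex]
  rw [t.fst_unique hex.choose_spec h]

lemma Matching.alternative_inl_of_forall {i : Fin M₁} (h : ¬ ∃ j, (i, j) ∈ t.1) :
    t.alternative α β p (Sum.inl i) = p (Sum.inl i) := by
  simp only [Matching.alternative, Sum.elim_inl, dif_neg h]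

lemma Matching.alternative_inr_of_forall {j : Fin M₂} (h : ¬ ∃ i, (i, j) ∈ t.1) :
    t.alternative α β p (Sum.inr j) = p (Sum.inr j) := by
  simp only [Matching.alternative, Sum.elim_inr, dif_neg h]

lemma Matching.alternative_congr {s s' : Fin M₁ ⊕ Fin M₂} (h : t.label s = t.label s') :
    t.alternative α β p s = t.alternative α β p s' := by
  rcases s with i | j <;> rcases s' with i' | j'
  · rw [t.label_inl, t.label_inl, Fin.val_inj] at h
    rw [h]
  · rw [t.label_inl_eq_inr_iff] at h
    rw [t.alternative_inl h, t.alternative_inr h]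
  · rw [eq_comm, t.label_inl_eq_inr_iff] at h
    rw [t.alternative_inl h, t.alternative_inr h]
  · rw [t.label_inr_injective h]

/-- The alternatives inherit properties shared by the original and the tilted distributions. -/
lemma Matching.alternative_induction {C : (X → ℝ) → Prop} (h₁ : ∀ s, C (p s))
    (h₂ : ∀ s s', C (tilted α β (p s) (p s'))) (s : Fin M₁ ⊕ Fin M₂) :
    C (t.alternative α β p s) := by
  rcases s with i | j
  · by_cases h : ∃ j, (i, j) ∈ t.1
    · obtain ⟨j, hj⟩ := h
      rw [t.alternative_inl hj]
      exact h₂ _ _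
    · rw [t.alternative_inl_of_forall h]
      exact h₁ _
  · by_cases h : ∃ i, (i, j) ∈ t.1
    · obtain ⟨i, hi⟩ := h
      rw [t.alternative_inr hi]
      exact h₂ _ _
    · rw [t.alternative_inr_of_forall h]
      exact h₁ _

/-- The relative entropy rate of the alternative. -/
lemma Matching.sum_klSum_alternative [Nonempty X] (hα : 0 < α) (hβ : 0 < β)
    (hp : ∀ s x, 0 < p s x) :
    ∑ s, obsRate M₁ M₂ α β s * klSum (t.alternative α β p s) (p s) =
      ∑ q ∈ t.1, -(α + β) * Real.log (overlap α β (p (Sum.inl q.1)) (p (Sum.inr q.2))) := by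
  classical
  have h1 : ∑ i, α * klSum (t.alternative α β p (Sum.inl i)) (p (Sum.inl i)) =
      ∑ q ∈ t.1, α * klSum (tilted α β (p (Sum.inl q.1)) (p (Sum.inr q.2))) (p (Sum.inl q.1)) := by
    rw [← Finset.sum_subset (Finset.subset_univ (t.1.image Prod.fst)) fun i _ hi => by
      rw [t.alternative_inl_of_forall fun ⟨j, hj⟩ => hi (Finset.mem_image_of_mem _ hj),
        klSum_self (hp _), mul_zero], Finset.sum_image t.2.2.1]
    exact Finset.sum_congr rfl fun q hq => by rw [t.alternative_inl hq]
  have h2 : ∑ j, β * klSum (t.alternative α β p (Sum.inr j)) (p (Sum.inr j)) =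
      ∑ q ∈ t.1, β * klSum (tilted α β (p (Sum.inl q.1)) (p (Sum.inr q.2))) (p (Sum.inr q.2)) := by
    rw [← Finset.sum_subset (Finset.subset_univ (t.1.image Prod.snd)) fun j _ hj => by
      rw [t.alternative_inr_of_forall fun ⟨i, hi⟩ => hj (Finset.mem_image_of_mem _ hi),
        klSum_self (hp _), mul_zero], Finset.sum_image t.2.2.2]
    exact Finset.sum_congr rfl fun q hq => by rw [t.alternative_inr hq]
  rw [Fintype.sum_sum_type]
  change ∑ i, α * _ + ∑ j, β * _ = _
  rw [h1, h2, ← Finset.sum_add_distrib]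
  exact Finset.sum_congr rfl fun q _ => klSum_tilted (hp _) (hp _) hα hβ

end

lemma coe_sum {ι : Type*} (s : Finset ι) (f : ι → ℝ) :
    ((∑ i ∈ s, f i : ℝ) : EReal) = ∑ i ∈ s, (f i : EReal) := by
  classical
  induction s using Finset.induction_on with
  | empty => simp
  | insert i s hi ih => rw [Finset.sum_insert hi, Finset.sum_insert hi, EReal.coe_add, ih]

section

variable {X : Type*} [Fintype X] [MeasurableSpace X] {M₁ M₂ K : ℕ} {α β : ℝ}

/-- Alternatives under which `t` is true, with distinct distributions in each database and with
relative entropy rate arbitrarily close to the term of `t` in the exponent. -/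
lemma exists_alternative (hα : 0 < α) (hβ : 0 < β) {t l : Matching M₁ M₂ K} (htl : t ≠ l)
    {P : Fin M₁ → PMF X} {Q : Fin M₂ → PMF X} (hl : IsGenerating l P Q) (hPQ : FullSupport P Q)
    {c : ℝ} (hc : ∑ p ∈ t.1 \ l.1, (α : EReal) * renyiDiv (β / (α + β)) (Q p.2) (P p.1) < c) :
    ∃ (P' : Fin M₁ → PMF X) (Q' : Fin M₂ → PMF X), IsGenerating t P' Q' ∧ FullSupport P' Q' ∧
      Function.Injective P' ∧ Function.Injective Q' ∧
      ∑ s, obsRate M₁ M₂ α β s * symbolDiv (Sum.elim P' Q') (Sum.elim P Q) s < c := by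
  obtain ⟨q, hq⟩ := Matching.sdiff_nonempty htl
  have hX : Nontrivial X := by
    by_contra hX
    rw [not_nontrivial_iff_subsingleton] at hX
    refine (Finset.mem_sdiff.1 hq).2 ((hl q.1 q.2).1 (PMF.ext fun x => ?_))
    have h : ∀ r : PMF X, r x = 1 := fun r => by
      have := r.tsum_coe
      rwa [tsum_fintype, Fintype.sum_subsingleton _ x] at this
    rw [h, h]
  let p : Fin M₁ ⊕ Fin M₂ → X → ℝ := fun s x => (Sum.elim P Q s x).toReal
  have hp : ∀ s x, 0 < p s x := fun s x => by
    refine ENNReal.toReal_pos ?_ (PMF.apply_ne_top _ _)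
    rcases s with i | j
    · exact hPQ.1 i x
    · exact hPQ.2 j x
  have hp1 : ∀ s, ∑ x, p s x = 1 := fun s => PMF_sum_toReal _
  have hcost : ∑ s, obsRate M₁ M₂ α β s * klSum (t.alternative α β p s) (p s) < c := by
    rw [t.sum_klSum_alternative hα hβ hp, ← EReal.coe_lt_coe_iff,
      ← Finset.sum_subset (Finset.sdiff_subset (s := t.1) (t := l.1)) fun q hq hq' => ?_, coe_sum]
    · rwa [Finset.sum_congr rfl fun q _ => (mul_renyiDiv_of_pos hα hβ
        (overlap_pos (hp (Sum.inl q.1)) (hp (Sum.inr q.2)))).symm]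
    · have hql : q ∈ l.1 := by
        by_contra h
        exact hq' (Finset.mem_sdiff.2 ⟨hq, h⟩)
      have : p (Sum.inr q.2) = p (Sum.inl q.1) := by
        simp only [p, Sum.elim_inl, Sum.elim_inr, (hl q.1 q.2).2 hql]
      rw [this, overlap_self hα hβ (hp _) (hp1 _), Real.log_one, mul_zero]
  obtain ⟨D, hD, hDk, hDc⟩ := exists_perturbation (t.alternative α β p)
    (t.alternative_induction (C := fun v => ∀ x, 0 < v x) hp fun s s' => tilted_pos (hp s) (hp s'))
    (t.alternative_induction (C := fun v => ∑ x, v x = 1) hp1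
      fun s s' => sum_tilted (hp s) (hp s'))
    t.label (fun _ _ => t.alternative_congr) (obsRate M₁ M₂ α β) p hp hcost
  have hsum : Sum.elim (fun i => D (Sum.inl i)) (fun j => D (Sum.inr j)) = D := by
    funext s; rcases s <;> rfl
  refine ⟨fun i => D (Sum.inl i), fun j => D (Sum.inr j), fun i j => ?_, ⟨fun i => hD _,
    fun j => hD _⟩, fun i i' h => ?_, fun j j' h => ?_, ?_⟩
  · rw [hDk, t.label_inl_eq_inr_iff]
  · have := (hDk _ _).1 h
    rwa [t.label_inl, t.label_inl, Fin.val_inj] at this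
  · exact t.label_inr_injective ((hDk _ _).1 h)
  · rw [hsum]
    exact hDc

/-- No consistent universal test has a larger exponent. -/
lemma limsup_mismatchRate_le [MeasurableSingletonClass X] (hα : 0 < α) (hβ : 0 < β)
    {Φ : ℕ → SeqTest X M₁ M₂ K α β} (huniv : ∀ᶠ N in atTop, (Φ N).IsUniversal N)
    (hcons : ∀ (t : Matching M₁ M₂ K) (P : Fin M₁ → PMF X) (Q : Fin M₂ → PMF X),
      IsGenerating t P Q → FullSupport P Q → Function.Injective P → Function.Injective Q →
      Tendsto (fun N => (Φ N).mismatchProb t P Q) atTop (𝓝 0))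
    {l : Matching M₁ M₂ K} {P : Fin M₁ → PMF X} {Q : Fin M₂ → PMF X}
    (hl : IsGenerating l P Q) (hPQ : FullSupport P Q) :
    limsup (fun N => (Φ N).mismatchRate N l P Q) atTop ≤ exponent α β l P Q := by
  refine le_iInf₂ fun t ht => EReal.le_of_forall_lt_iff_le.1 fun c hc => ?_
  obtain ⟨P', Q', h1, h2, h3, h4, h5⟩ := exists_alternative hα hβ ht hl hPQ hc
  exact limsup_le_of_le (by isBoundedDefault)
    (eventually_mismatchRate_le hα hβ huniv ht hPQ h2 h1 (hcons t P' Q' h1 h2 h3 h4) h5)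

end

end SeqMatching

theorem theorem1 {X : Type*} [Fintype X] [MeasurableSpace X] [MeasurableSingletonClass X]
    (M₁ M₂ K : ℕ) (hK : 1 ≤ K) (hKM : K ≤ M₂) (hM : M₂ ≤ M₁)
    (α β : ℝ) (hα : 0 < α) (hβ : 0 < β) :
    -- the proposed test exists for every parameter
    (∀ N : ℕ, ∃ Φ : SeqTest X M₁ M₂ K α β, IsProposedTest Φ N) ∧
    -- stopping time and achievability, for every way of breaking ties
    (∀ Φ : ℕ → SeqTest X M₁ M₂ K α β, (∀ N, IsProposedTest (Φ N) N) →
      (∀ N : ℕ, 2 ≤ N → ∃ B : ℕ, (Φ N).IsUniversal B) ∧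
      (∀ N : ℕ, 2 ≤ N → 1 ≤ α * (((N : ℝ) - 2) * α + 2) → (Φ N).IsUniversal N) ∧
      (∀ (l : Matching M₁ M₂ K) (P : Fin M₁ → PMF X) (Q : Fin M₂ → PMF X),
        IsGenerating l P Q →
        exponent α β l P Q ≤ liminf (fun N => (Φ N).mismatchRate N l P Q) atTop) ∧
      (∀ (l : Matching M₁ M₂ K) (P : Fin M₁ → PMF X) (Q : Fin M₂ → PMF X),
        IsGenerating l P Q → FullSupport P Q →
        Tendsto (fun N => (Φ N).mismatchRate N l P Q) atTop (𝓝 (exponent α β l P Q)))) ∧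
    -- converse
    (∀ Φ : ℕ → SeqTest X M₁ M₂ K α β,
      (∀ᶠ N in atTop, (Φ N).IsUniversal N) →
      (∀ (t : Matching M₁ M₂ K) (P : Fin M₁ → PMF X) (Q : Fin M₂ → PMF X),
        IsGenerating t P Q → FullSupport P Q → Function.Injective P → Function.Injective Q →
        Tendsto (fun N => (Φ N).mismatchProb t P Q) atTop (𝓝 0)) →
      ∀ (l : Matching M₁ M₂ K) (P : Fin M₁ → PMF X) (Q : Fin M₂ → PMF X),
        IsGenerating l P Q → FullSupport P Q →
        limsup (fun N => (Φ N).mismatchRate N l P Q) atTop ≤ exponent α β l P Q) := by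
  refine ⟨exists_isProposedTest hKM hM, fun Φ hΦ => ⟨fun N hN =>
    (hΦ N).exists_isUniversal hα hβ hN, fun N hN hN' => (hΦ N).isUniversal hα hβ hN hN',
    fun l P Q hl => exponent_le_liminf hα hβ hΦ hl, fun l P Q hl hPQ => ?_⟩,
    fun Φ huniv hcons l P Q hl hPQ => limsup_mismatchRate_le hα hβ huniv hcons hl hPQ⟩
  exact tendsto_of_le_liminf_of_limsup_le (exponent_le_liminf hα hβ hΦ hl)
    (limsup_mismatchRate_le hα hβ (eventually_isUniversal hα hβ hΦ)
      (fun t P Q ht _ _ _ => tendsto_mismatchProb hα hβ hΦ ht) hl hPQ)
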